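/- Let $\nu\in(0,1]$, let $n\ge 1$ be an integer, put $\alpha=\nu/n$, and let $(\mathfrak H_\alpha(t))_{t\ge 0}$ be an $\alpha$-stable subordinator, i.e. a nondecreasing Lévy process started at $0$ with $\mathbb E\,e^{-\lambda \mathfrak H_\alpha(t)}=e^{-t\lambda^{\alpha}}$ for $\lambda>0$. Write $D^k_{0-,z}=(-1)^k\,\partial^k/\partial z^k$ for integers $k\ge 0$. For $\nu\in(0,1)$ let $$D^{\nu}_{0+,x}f(x)=\frac1{\Gamma(1-\nu)}\frac{d}{dx}\int_0^x (x-s)^{-\nu}f(s)\,ds$$ be the Riemann–Liouville derivative, and let $D^1_{0+,x}=d/dx$. For $a$ not a positive integer let $\Phi_a(x)=x^{-a}/\Gamma(1-a)$ for $x>0$ and $\Phi_a(x)=0$ for $x\le 0$. **Case $\alpha<1$.** For $t>0$ the law of $\mathfrak H_\alpha(t)$ has a density $h_\alpha(\cdot,t)\ge 0$ that vanishes on $(-\infty,0]$ and is jointly continuous on $\mathbb R\times(0,\infty)$. The derivatives below exist in the classical sense, and $$\left(D^{n}_{0-,t}-D^{\nu}_{0+,x}\right)h_{\nu/n}(x,t)=0,\qquad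 x>0,\ t>0.$$ Moreover: 1. $h_{\nu/n}(x,0)=\delta(x)$, in the sense that $\int\varphi(x)\,h_{\nu/n}(x,t)\,dx\to\varphi(0)$ as $t\to0^+$ for every bounded continuous $\varphi:\mathbb R\to\mathbb R$; 2. $h_{\nu/n}(0,t)=0=\lim_{x\to0^+}h_{\nu/n}(x,t)$ for $t>0$; 3. for all integers $0<k<n$ and all $x>0$, $$D^{k}_{0-,t}h_{\nu/n}(x,t)\Big|_{t=0^+}=\lim_{t\to0^+}D^{k}_{0-,t}h_{\nu/n}(x,t)=\Phi_{\nu k/n+1}(x);$$ 4. for all $\lambda,\xi>0$, $$\int_0^\infty e^{-\lambda t}\int_0^\infty e^{-\xi x}h_{\nu/n}(x,t)\,dx\,dt=\frac1{\lambda+\xi^{\nu/n}}.$$ **Case $\alpha=1$ (that is, $\nu=n=1$).** The law $\mu_t$ of $\mathfrak H_1(t)$ has no density, and the same problem is solved by the laws themselves. The equation $(-\partial_t-\partial_x)\mu=0$ holds in the sense of distributions on $(0,\infty)^2$, i.e. $\int_0^\infty\!\int(\partial_t\varphi+\partial_x\varphi)(x,t)\,\mu_t(dx)\,dt=0$ for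 all $\varphi\in C_c^\infty((0,\infty)^2)$. Further, $\mu_t\to\delta_0$ weakly as $t\to0^+$; for each $t>0$ there is $\varepsilon>0$ with $\mu_t((-\infty,\varepsilon))=0$; and for all $\lambda,\xi>0$ we have $\int_0^\infty e^{-\lambda t}\int_{(0,\infty)} e^{-\xi x}\,\mu_t(dx)\,dt=1/(\lambda+\xi)$. -/

import Mathlib

open MeasureTheory ProbabilityTheory Filter Topology Set
open scoped NNReal ContDiff BoundedContinuousFunction

noncomputable section

/-- The operator `D^n_{0-,z} = (-1)^n d^n/dz^n` of integer order `n`. -/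
def leftDeriv (n : ℕ) (f : ℝ → ℝ) (z : ℝ) : ℝ :=
  (-1) ^ n * iteratedDeriv n f z

/-- The Riemann-Liouville integral `(1 / Γ(β)) ∫_0^z (z - s)^(β - 1) f(s) ds`. -/
def rlIntegral (β : ℝ) (f : ℝ → ℝ) (z : ℝ) : ℝ :=
  (1 / Real.Gamma β) * ∫ s in (0 : ℝ)..z, (z - s) ^ (β - 1) * f s

/-- The Riemann-Liouville derivative `D^α_{0+,z}`, for `α ≥ 0`: the ordinary derivative when `α` is
an integer, and `d^m/dz^m` of the Riemann-Liouville integral of order `m - α` when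
`m - 1 < α < m`. -/
def rlDeriv (α : ℝ) (f : ℝ → ℝ) (z : ℝ) : ℝ :=
  if (⌈α⌉₊ : ℝ) = α then iteratedDeriv ⌈α⌉₊ f z
  else iteratedDeriv ⌈α⌉₊ (rlIntegral ((⌈α⌉₊ : ℝ) - α) f) z

/-- The classical derivative `D^α_{0+,z} f` exists at `z`: the integrals in its definition converge
near `z`, and the function that is differentiated is `⌈α⌉` times continuously differentiable
near `z`. -/
def RLDifferentiableAt (α : ℝ) (f : ℝ → ℝ) (z : ℝ) : Prop :=
  if (⌈α⌉₊ : ℝ) = α then ContDiffAt ℝ (⌈α⌉₊ : ℕ) f z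
  else
    (∀ᶠ y in 𝓝 z, IntervalIntegrable
      (fun s : ℝ => (y - s) ^ ((⌈α⌉₊ : ℝ) - α - 1) * f s) volume 0 y) ∧
    ContDiffAt ℝ (⌈α⌉₊ : ℕ) (rlIntegral ((⌈α⌉₊ : ℝ) - α) f) z

/-- `Φ_a(z) = z_+^(-a) / Γ(1 - a)`, for `a` not a positive integer. -/
def Phi (a z : ℝ) : ℝ :=
  if 0 < z then z ^ (-a) / Real.Gamma (1 - a) else 0

/-- `X` is an `α`-stable subordinator: a Lévy process started at `0` with nondecreasing paths and
`E exp(-l X_t) = exp(-t l^α)`. -/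
structure IsStableSubordinator {Ω : Type*} [MeasurableSpace Ω] (P : Measure Ω) (α : ℝ)
    (X : ℝ≥0 → Ω → ℝ) : Prop where
  measurable : ∀ t, Measurable (X t)
  start : ∀ᵐ w ∂P, X 0 w = 0
  paths : ∀ᵐ w ∂P, Monotone (fun t => X t w) ∧
    ∀ t, ContinuousWithinAt (fun s => X s w) (Ici t) t
  indep : HasIndepIncrements X P
  stationary : ∀ s t, IdentDistrib (fun w => X (s + t) w - X s w) (X t) P P
  laplace : ∀ t : ℝ≥0, ∀ l : ℝ, 0 < l →
    ∫ w, Real.exp (-(l * X t w)) ∂P = Real.exp (-((t : ℝ) * l ^ α))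

/-- The law of `X_t`, for a real time `t ≥ 0`. -/
def timeLaw {Ω : Type*} [MeasurableSpace Ω] (P : Measure Ω) (X : ℝ≥0 → Ω → ℝ) (t : ℝ) :
    Measure ℝ :=
  P.map (X t.toNNReal)

/-- `h(x, t)` is the continuous density of `X_t` for `t > 0`, where `X` is a nonnegative process:
`h` is continuous on `ℝ × (0, ∞)`, which determines it there, and it vanishes for `x ≤ 0`. -/
structure IsContinuousDensity {Ω : Type*} [MeasurableSpace Ω] (P : Measure Ω)
    (X : ℝ≥0 → Ω → ℝ) (h : ℝ → ℝ → ℝ) : Prop where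
  nonneg : ∀ x t, 0 < t → 0 ≤ h x t
  zero : ∀ x t, 0 < t → x ≤ 0 → h x t = 0
  continuousOn : ContinuousOn (fun p : ℝ × ℝ => h p.1 p.2) (univ ×ˢ Ioi 0)
  law : ∀ t, 0 < t → timeLaw P X t = volume.withDensity (fun x => ENNReal.ofReal (h x t))

end

open scoped FourierTransform

/-! ### The Bromwich integral -/

/-! For `α < 1` everything is read off from `B_s(x, t) = (2πi)⁻¹ ∫ exp (zx - t z^α) z^s dz` over `Re
z = 1`, with density `h = Re B_0`. The real part of `z^α` dominates a multiple of `|z|^α`, so for `t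
> 0` the integral converges for every `s` and may be differentiated freely: `-∂_t` raises `s` by `α`
and `∂_x` raises it by `1`. The Riemann–Liouville integral of order `a` lowers `s` by `a`, because
`h` vanishes for `x ≤ 0` and `∫ u^(a-1) e^(-zu) du = Γ(a) z^(-a)`. Hence both `D^n_{0-,t} h` and
`D^ν_{0+,x} h` equal `Re B_ν`, as `nα = ν`.

That `h` is the density follows by continuing the Laplace transform to `Re z > 0` and reading it on
`Re z = 1` as the characteristic function of the law tilted by `e^(-x)`
(`eq_withDensity_bromwichIntegral`).

The limit of `D^k_{0-,t} h` at `t = 0` is delicate, since `z^(kα)` is not integrable. Two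
integrations by parts (`sq_mul_bromwichIntegral`) trade `x²` for `z^(-2)`, and the remaining terms
carry powers of `t` that kill them (`tendsto_bromwichIntegral_time_zero`).

For `α = 1` the law is `δ_t`, and the equation becomes the fundamental theorem of calculus along the
diagonal. -/

/-- The point `1 + 2 π i w` of the line `Re z = 1`. -/
noncomputable def bromwichPoint (w : ℝ) : ℂ := 1 + 2 * Real.pi * w * Complex.I

/-- The integrand `exp (z x - t z ^ α) z ^ s`, at `z = 1 + 2 π i w`. -/
noncomputable def bromwichKernel (α s x t w : ℝ) : ℂ :=
  Complex.exp (bromwichPoint w * x - t * bromwichPoint w ^ (α : ℂ)) * bromwichPoint w ^ (s : ℂ)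

/-- The inverse Laplace transform `(2 π i)⁻¹ ∫ exp (z x - t z ^ α) z ^ s dz` along `Re z = 1`. -/
noncomputable def bromwichIntegral (α s x t : ℝ) : ℂ := ∫ w, bromwichKernel α s x t w

lemma bromwichPoint_re (w : ℝ) : (bromwichPoint w).re = 1 := by
  simp [bromwichPoint]

lemma bromwichPoint_im (w : ℝ) : (bromwichPoint w).im = 2 * Real.pi * w := by
  simp [bromwichPoint]

lemma bromwichPoint_mem_slitPlane (w : ℝ) : bromwichPoint w ∈ Complex.slitPlane :=
  Or.inl (by simp [bromwichPoint_re])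

lemma bromwichPoint_ne_zero (w : ℝ) : bromwichPoint w ≠ 0 :=
  Complex.slitPlane_ne_zero (bromwichPoint_mem_slitPlane w)

lemma one_le_norm_bromwichPoint (w : ℝ) : 1 ≤ ‖bromwichPoint w‖ := by
  simpa [bromwichPoint_re] using Complex.abs_re_le_norm (bromwichPoint w)

lemma norm_bromwichPoint_pos (w : ℝ) : 0 < ‖bromwichPoint w‖ :=
  zero_lt_one.trans_le (one_le_norm_bromwichPoint w)

lemma one_add_sq_le_norm_bromwichPoint_sq (w : ℝ) : 1 + ‖w‖ ^ 2 ≤ ‖bromwichPoint w‖ ^ 2 := by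
  rw [← Complex.normSq_eq_norm_sq, Complex.normSq_apply, bromwichPoint_re, bromwichPoint_im,
    Real.norm_eq_abs, sq_abs]
  have : 1 ≤ (2 * Real.pi) ^ 2 := by nlinarith [Real.pi_gt_three]
  nlinarith [sq_nonneg w]

lemma continuous_bromwichPoint : Continuous bromwichPoint := by
  unfold bromwichPoint; fun_prop

lemma hasDerivAt_bromwichPoint (w : ℝ) :
    HasDerivAt bromwichPoint (2 * Real.pi * Complex.I) w := by
  unfold bromwichPoint
  have h := ((Complex.ofRealCLM.hasDerivAt (x := w)).const_mul
    (2 * Real.pi : ℂ)).mul_const Complex.I |>.const_add 1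
  simpa using h

lemma continuous_bromwichPoint_cpow (s : ℂ) : Continuous fun w => bromwichPoint w ^ s :=
  continuous_bromwichPoint.cpow continuous_const bromwichPoint_mem_slitPlane

lemma continuous_bromwichKernel (α s : ℝ) :
    Continuous fun p : (ℝ × ℝ) × ℝ => bromwichKernel α s p.1.1 p.1.2 p.2 := by
  have hx : Continuous fun p : (ℝ × ℝ) × ℝ => (p.1.1 : ℂ) :=
    Complex.continuous_ofReal.comp continuous_fst.fst
  have ht : Continuous fun p : (ℝ × ℝ) × ℝ => (p.1.2 : ℂ) :=
    Complex.continuous_ofReal.comp continuous_fst.snd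
  exact (Complex.continuous_exp.comp (((continuous_bromwichPoint.comp continuous_snd).mul hx).sub
    (ht.mul ((continuous_bromwichPoint_cpow α).comp continuous_snd)))).mul
    ((continuous_bromwichPoint_cpow s).comp continuous_snd)

lemma continuous_bromwichKernel_right (α s x t : ℝ) : Continuous (bromwichKernel α s x t) :=
  (Complex.continuous_exp.comp ((continuous_bromwichPoint.mul continuous_const).sub
    (continuous_const.mul (continuous_bromwichPoint_cpow α)))).mul
    (continuous_bromwichPoint_cpow s)

lemma integrable_norm_bromwichPoint_rpow {p : ℝ} (hp : p < -1) :
    Integrable fun w : ℝ => ‖bromwichPoint w‖ ^ p := by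
  have h := integrable_rpow_neg_one_add_norm_sq (E := ℝ) (μ := volume) (r := -p)
    (by simpa using by linarith)
  refine h.mono' ?_ (Eventually.of_forall fun w => ?_)
  · exact (continuous_bromwichPoint.norm.rpow_const
      fun w => Or.inl (norm_bromwichPoint_pos w).ne').aestronglyMeasurable
  · rw [Real.norm_of_nonneg (by positivity)]
    calc ‖bromwichPoint w‖ ^ p = (‖bromwichPoint w‖ ^ 2) ^ (p / 2) := by
          rw [← Real.rpow_natCast, ← Real.rpow_mul (norm_nonneg _)]; congr 1; push_cast; ring
      _ ≤ (1 + ‖w‖ ^ 2) ^ (p / 2) := Real.rpow_le_rpow_of_nonpos (by positivity)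
          (one_add_sq_le_norm_bromwichPoint_sq w) (by linarith)
      _ = _ := by rw [neg_neg]

/-! ### Decay of the kernel along the line -/

/-- Since `|arg z| < π/2`, the argument of `z^α` stays within `απ/2`. For `α < 1` this cosine is
positive, which is the source of all decay. -/
lemma cos_mul_rpow_norm_le_re_bromwichPoint_cpow {α : ℝ} (h0 : 0 < α) (h1 : α < 1) (w : ℝ) :
    Real.cos (α * (Real.pi / 2)) * ‖bromwichPoint w‖ ^ α ≤ (bromwichPoint w ^ (α : ℂ)).re := by
  have harg : |(bromwichPoint w).arg| < Real.pi / 2 :=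
    Complex.abs_arg_lt_pi_div_two_iff.2 (Or.inl (by simp [bromwichPoint_re]))
  rw [Complex.cpow_ofReal_re, mul_comm]
  gcongr
  rw [← Real.cos_abs ((bromwichPoint w).arg * α), abs_mul, abs_of_pos h0, mul_comm _ α]
  apply Real.cos_le_cos_of_nonneg_of_le_pi (by positivity)
  · nlinarith [Real.pi_pos]
  · gcongr

lemma cos_mul_pi_div_two_pos {α : ℝ} (h0 : 0 < α) (h1 : α < 1) :
    0 < Real.cos (α * (Real.pi / 2)) :=
  Real.cos_pos_of_mem_Ioo ⟨by nlinarith [Real.pi_pos], by nlinarith [Real.pi_pos]⟩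

lemma norm_bromwichKernel (α s x t w : ℝ) : ‖bromwichKernel α s x t w‖ =
    Real.exp (x - t * (bromwichPoint w ^ (α : ℂ)).re) * ‖bromwichPoint w‖ ^ s := by
  rw [bromwichKernel, norm_mul, Complex.norm_exp, Complex.norm_cpow_real]
  simp [Complex.mul_re, bromwichPoint_re]

/-- With `u = t |z|^α`, each extra power `|z|^α` is paid for by a factor `t`, and `u^j e^(-cu) ≤
j!/c^j`. The bound does not depend on `t`, so it survives `t → 0`. -/
lemma pow_mul_norm_bromwichKernel_le {α : ℝ} (h0 : 0 < α) (h1 : α < 1) (p x w : ℝ) (j : ℕ)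
    {t : ℝ} (ht : 0 ≤ t) : t ^ j * ‖bromwichKernel α (p + j * α) x t w‖ ≤
      Real.exp x * (j.factorial / Real.cos (α * (Real.pi / 2)) ^ j) * ‖bromwichPoint w‖ ^ p := by
  set c := Real.cos (α * (Real.pi / 2)) with hc
  have hcp : 0 < c := cos_mul_pi_div_two_pos h0 h1
  have hz := norm_bromwichPoint_pos w
  set u := t * ‖bromwichPoint w‖ ^ α with hu
  have hu0 : 0 ≤ u := by positivity
  have hpow : ‖bromwichPoint w‖ ^ (p + j * α) =
      ‖bromwichPoint w‖ ^ p * (‖bromwichPoint w‖ ^ α) ^ j := by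
    rw [Real.rpow_add hz, mul_comm (j : ℝ) α, Real.rpow_mul hz.le, Real.rpow_natCast]
  have hexp : Real.exp (x - t * (bromwichPoint w ^ (α : ℂ)).re) ≤
      Real.exp x * Real.exp (-(c * u)) := by
    rw [← Real.exp_add, Real.exp_le_exp]
    have := mul_le_mul_of_nonneg_left (cos_mul_rpow_norm_le_re_bromwichPoint_cpow h0 h1 w) ht
    rw [← hc] at this
    rw [hu]
    linarith
  have hfac : u ^ j * Real.exp (-(c * u)) ≤ j.factorial / c ^ j := by
    have := Real.pow_div_factorial_le_exp (c * u) (by positivity) j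
    rw [Real.exp_neg, ← div_eq_mul_inv, div_le_div_iff₀ (Real.exp_pos _) (by positivity)]
    rw [div_le_iff₀ (by positivity), mul_pow] at this
    linarith
  calc t ^ j * ‖bromwichKernel α (p + j * α) x t w‖
      = Real.exp (x - t * (bromwichPoint w ^ (α : ℂ)).re) * (u ^ j * ‖bromwichPoint w‖ ^ p) := by
        rw [norm_bromwichKernel, hpow, hu, mul_pow]; ring
    _ ≤ Real.exp x * Real.exp (-(c * u)) * (u ^ j * ‖bromwichPoint w‖ ^ p) := by gcongr
    _ = Real.exp x * (u ^ j * Real.exp (-(c * u))) * ‖bromwichPoint w‖ ^ p := by ring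
    _ ≤ _ := by gcongr

lemma exists_norm_bromwichKernel_le {α : ℝ} (h0 : 0 < α) (h1 : α < 1) (s : ℝ) {δ : ℝ}
    (hδ : 0 < δ) : ∃ C : ℝ, 0 ≤ C ∧ ∀ x t w : ℝ, δ ≤ t →
      ‖bromwichKernel α s x t w‖ ≤ Real.exp x * C * ‖bromwichPoint w‖ ^ (-2 : ℝ) := by
  -- Chosen so that `s ≤ -2 + jα`; the exponent `-2` is just an integrable one.
  obtain ⟨j, hj⟩ := exists_nat_ge ((s + 2) / α)
  rw [div_le_iff₀ h0] at hj
  have hcp : 0 < Real.cos (α * (Real.pi / 2)) := cos_mul_pi_div_two_pos h0 h1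
  refine ⟨j.factorial / Real.cos (α * (Real.pi / 2)) ^ j / δ ^ j, by positivity,
    fun x t w ht => ?_⟩
  have hmono : ‖bromwichKernel α s x t w‖ ≤ ‖bromwichKernel α (-2 + j * α) x t w‖ := by
    rw [norm_bromwichKernel, norm_bromwichKernel]
    gcongr
    · exact one_le_norm_bromwichPoint w
    · linarith
  have hb := pow_mul_norm_bromwichKernel_le h0 h1 (-2) x w j (hδ.le.trans ht)
  have ht' : δ ^ j ≤ t ^ j := pow_le_pow_left₀ hδ.le ht j
  have hkey : δ ^ j * ‖bromwichKernel α s x t w‖ ≤ t ^ j * ‖bromwichKernel α (-2 + j * α) x t w‖ :=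
    mul_le_mul ht' hmono (norm_nonneg _) (by have := hδ.le.trans ht; positivity)
  have := hkey.trans hb
  rw [← le_div_iff₀' (by positivity)] at this
  refine this.trans (le_of_eq ?_)
  ring

lemma integrable_bromwichKernel {α : ℝ} (h0 : 0 < α) (h1 : α < 1) (s x : ℝ) {t : ℝ}
    (ht : 0 < t) : Integrable (bromwichKernel α s x t) := by
  obtain ⟨C, -, hC⟩ := exists_norm_bromwichKernel_le h0 h1 s ht
  exact ((integrable_norm_bromwichPoint_rpow (p := -2) (by norm_num)).const_mul _).mono'
    (continuous_bromwichKernel_right α s x t).aestronglyMeasurable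
    (Eventually.of_forall fun w => hC x t w le_rfl)

lemma exists_norm_bromwichIntegral_le {α : ℝ} (h0 : 0 < α) (h1 : α < 1) (s : ℝ) {t : ℝ}
    (ht : 0 < t) : ∃ C : ℝ, 0 ≤ C ∧ ∀ x, ‖bromwichIntegral α s x t‖ ≤ Real.exp x * C := by
  obtain ⟨C, hC0, hC⟩ := exists_norm_bromwichKernel_le h0 h1 s ht
  refine ⟨C * ∫ w, ‖bromwichPoint w‖ ^ (-2 : ℝ),
    mul_nonneg hC0 (integral_nonneg fun w => by positivity), fun x => ?_⟩
  calc ‖bromwichIntegral α s x t‖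
      ≤ ∫ w, Real.exp x * C * ‖bromwichPoint w‖ ^ (-2 : ℝ) :=
        norm_integral_le_of_norm_le
          ((integrable_norm_bromwichPoint_rpow (p := -2) (by norm_num)).const_mul _)
          (Eventually.of_forall fun w => hC x t w le_rfl)
    _ = _ := by rw [integral_const_mul, mul_assoc]

lemma continuousOn_bromwichIntegral {α : ℝ} (h0 : 0 < α) (h1 : α < 1) (s : ℝ) :
    ContinuousOn (fun p : ℝ × ℝ => bromwichIntegral α s p.1 p.2) (univ ×ˢ Ioi 0) := by
  rintro ⟨x₀, t₀⟩ ⟨-, ht₀ : 0 < t₀⟩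
  apply ContinuousAt.continuousWithinAt
  obtain ⟨C, hC0, hC⟩ := exists_norm_bromwichKernel_le h0 h1 s (half_pos ht₀)
  refine continuousAt_of_dominated
    (bound := fun w => Real.exp (x₀ + 1) * C * ‖bromwichPoint w‖ ^ (-2 : ℝ))
    (Eventually.of_forall fun p =>
      (continuous_bromwichKernel_right α s p.1 p.2).aestronglyMeasurable)
    ?_ ((integrable_norm_bromwichPoint_rpow (p := -2) (by norm_num)).const_mul _)
    (Eventually.of_forall fun w =>
      ((continuous_bromwichKernel α s).comp (Continuous.prodMk_left w)).continuousAt)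
  have hn : Iio (x₀ + 1) ×ˢ Ioi (t₀ / 2) ∈ 𝓝 (x₀, t₀) :=
    prod_mem_nhds (Iio_mem_nhds (by linarith)) (Ioi_mem_nhds (by linarith))
  filter_upwards [hn] with p hp
  refine Eventually.of_forall fun w => (hC p.1 p.2 w (le_of_lt hp.2)).trans ?_
  have : p.1 ≤ x₀ + 1 := le_of_lt hp.1
  gcongr

lemma bromwichPoint_cpow_add (s s' w : ℝ) : bromwichPoint w ^ ((s + s' : ℝ) : ℂ) =
    bromwichPoint w ^ (s : ℂ) * bromwichPoint w ^ (s' : ℂ) := by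
  rw [Complex.ofReal_add, Complex.cpow_add _ _ (bromwichPoint_ne_zero w)]

lemma hasDerivAt_bromwichKernel_time (α s x t w : ℝ) :
    HasDerivAt (fun t => bromwichKernel α s x t w) (-bromwichKernel α (s + α) x t w) t := by
  have h1 : HasDerivAt (fun t : ℝ => bromwichPoint w * x - t * bromwichPoint w ^ (α : ℂ))
      (-(bromwichPoint w ^ (α : ℂ))) t := by
    simpa using (((Complex.ofRealCLM.hasDerivAt (x := t)).mul_const
      (bromwichPoint w ^ (α : ℂ))).const_sub (bromwichPoint w * x))
  have h2 := h1.cexp.mul_const (bromwichPoint w ^ (s : ℂ))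
  unfold bromwichKernel
  refine h2.congr_deriv ?_
  rw [bromwichPoint_cpow_add]; ring

lemma hasDerivAt_bromwichKernel_space (α s x t w : ℝ) :
    HasDerivAt (fun x => bromwichKernel α s x t w) (bromwichKernel α (s + 1) x t w) x := by
  have h1 : HasDerivAt (fun x : ℝ => bromwichPoint w * x - t * bromwichPoint w ^ (α : ℂ))
      (bromwichPoint w) x := by
    simpa using (((Complex.ofRealCLM.hasDerivAt (x := x)).const_mul
      (bromwichPoint w)).sub_const (t * bromwichPoint w ^ (α : ℂ)))
  have h2 := h1.cexp.mul_const (bromwichPoint w ^ (s : ℂ))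
  unfold bromwichKernel
  refine h2.congr_deriv ?_
  rw [bromwichPoint_cpow_add, Complex.ofReal_one, Complex.cpow_one]; ring

lemma hasDerivAt_bromwichIntegral_time {α : ℝ} (h0 : 0 < α) (h1 : α < 1) (s x : ℝ) {t : ℝ}
    (ht : 0 < t) :
    HasDerivAt (fun t => bromwichIntegral α s x t) (-bromwichIntegral α (s + α) x t) t := by
  obtain ⟨C, hC0, hC⟩ := exists_norm_bromwichKernel_le h0 h1 (s + α) (half_pos ht)
  have h := (hasDerivAt_integral_of_dominated_loc_of_deriv_le (μ := volume)
    (F := fun t w => bromwichKernel α s x t w) (F' := fun t w => -bromwichKernel α (s + α) x t w)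
    (bound := fun w => Real.exp x * C * ‖bromwichPoint w‖ ^ (-2 : ℝ))
    (Ioi_mem_nhds (half_lt_self ht))
    (Eventually.of_forall fun t => (continuous_bromwichKernel_right α s x t).aestronglyMeasurable)
    (integrable_bromwichKernel h0 h1 s x ht)
    (continuous_bromwichKernel_right α (s + α) x t).neg.aestronglyMeasurable
    (Eventually.of_forall fun w u hu => by
      rw [norm_neg]; exact hC x u w (le_of_lt hu))
    ((integrable_norm_bromwichPoint_rpow (p := -2) (by norm_num)).const_mul _)
    (Eventually.of_forall fun w u _ => hasDerivAt_bromwichKernel_time α s x u w)).2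
  rw [integral_neg] at h
  exact h

lemma hasDerivAt_bromwichIntegral_space {α : ℝ} (h0 : 0 < α) (h1 : α < 1) (s x : ℝ) {t : ℝ}
    (ht : 0 < t) :
    HasDerivAt (fun x => bromwichIntegral α s x t) (bromwichIntegral α (s + 1) x t) x := by
  obtain ⟨C, hC0, hC⟩ := exists_norm_bromwichKernel_le h0 h1 (s + 1) ht
  exact (hasDerivAt_integral_of_dominated_loc_of_deriv_le (μ := volume)
    (F := fun x w => bromwichKernel α s x t w) (F' := fun x w => bromwichKernel α (s + 1) x t w)
    (bound := fun w => Real.exp (x + 1) * C * ‖bromwichPoint w‖ ^ (-2 : ℝ))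
    (Iio_mem_nhds (lt_add_one x))
    (Eventually.of_forall fun x => (continuous_bromwichKernel_right α s x t).aestronglyMeasurable)
    (integrable_bromwichKernel h0 h1 s x ht)
    (continuous_bromwichKernel_right α (s + 1) x t).aestronglyMeasurable
    (Eventually.of_forall fun w y hy => by
      refine (hC y t w le_rfl).trans ?_
      have : y ≤ x + 1 := le_of_lt hy
      gcongr)
    ((integrable_norm_bromwichPoint_rpow (p := -2) (by norm_num)).const_mul _)
    (Eventually.of_forall fun w y _ => hasDerivAt_bromwichKernel_space α s y t w)).2

/-- Integration by parts in the Bromwich integral. -/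
lemma mul_bromwichIntegral {α : ℝ} (h0 : 0 < α) (h1 : α < 1) (s x : ℝ) {t : ℝ} (ht : 0 < t) :
    x * bromwichIntegral α s x t =
      -(s * bromwichIntegral α (s - 1) x t) + α * t * bromwichIntegral α (s + α - 1) x t := by
  have hd : ∀ w, HasDerivAt (bromwichKernel α s x t)
      ((2 * Real.pi * Complex.I) * (x * bromwichKernel α s x t w +
        (s * bromwichKernel α (s - 1) x t w - α * t * bromwichKernel α (s + α - 1) x t w))) w := by
    intro w
    have hz := hasDerivAt_bromwichPoint w
    have hm := bromwichPoint_mem_slitPlane w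
    have hcp : ∀ a : ℝ, HasDerivAt (fun w => bromwichPoint w ^ (a : ℂ))
        (a * bromwichPoint w ^ ((a : ℂ) - 1) * (2 * Real.pi * Complex.I)) w := fun a => by
      simpa [Function.comp_def] using
        ((hasDerivAt_id (bromwichPoint w)).cpow_const (c := (a : ℂ)) hm).comp w hz
    have h2 := ((hz.mul_const (x : ℂ)).sub ((hcp α).const_mul (t : ℂ))).cexp.mul (hcp s)
    unfold bromwichKernel
    refine h2.congr_deriv ?_
    have e1 : bromwichPoint w ^ ((s : ℂ) - 1) = bromwichPoint w ^ ((s - 1 : ℝ) : ℂ) := by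
      push_cast; rfl
    have e2 : bromwichPoint w ^ ((s + α - 1 : ℝ) : ℂ) =
        bromwichPoint w ^ (s : ℂ) * bromwichPoint w ^ ((α : ℂ) - 1) := by
      rw [add_sub_assoc, bromwichPoint_cpow_add]; push_cast; rfl
    rw [e1, e2]
    simp only [Pi.sub_apply]
    ring
  have i0 := integrable_bromwichKernel h0 h1 s x ht
  have i1 := integrable_bromwichKernel h0 h1 (s - 1) x ht
  have i2 := integrable_bromwichKernel h0 h1 (s + α - 1) x ht
  have hint := integral_eq_zero_of_hasDerivAt_of_integrable hd
    (((i0.const_mul _).add ((i1.const_mul _).sub (i2.const_mul _))).const_mul _) i0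
  have e1 := integral_add (i0.const_mul (x : ℂ)) ((i1.const_mul (s : ℂ)).sub
    (i2.const_mul (α * t : ℂ)))
  simp only [Pi.sub_apply] at e1
  rw [integral_const_mul, e1, integral_sub (i1.const_mul _) (i2.const_mul _)] at hint
  simp only [integral_const_mul, mul_eq_zero] at hint
  have h3 := hint.resolve_left (by simp [Real.pi_ne_zero])
  unfold bromwichIntegral
  linear_combination h3

/-- Integration by parts applied twice. It serves both for decay in `x` and for lowering the
exponent by `2` before letting `t → 0`; each gain of `α` in the exponent comes with a factor `t`. -/
lemma sq_mul_bromwichIntegral {α : ℝ} (h0 : 0 < α) (h1 : α < 1) (s x : ℝ) {t : ℝ} (ht : 0 < t) :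
    (x : ℂ) ^ 2 * bromwichIntegral α s x t =
      s * (s - 1) * bromwichIntegral α (s - 2) x t
        - α * (2 * s + α - 1) * (t * bromwichIntegral α (s - 2 + α) x t)
        + α ^ 2 * (t ^ 2 * bromwichIntegral α (s - 2 + 2 * α) x t) := by
  have e1 := mul_bromwichIntegral h0 h1 s x ht
  have e2 := mul_bromwichIntegral h0 h1 (s - 1) x ht
  have e3 := mul_bromwichIntegral h0 h1 (s + α - 1) x ht
  rw [show s - 1 - 1 = s - 2 by ring, show s - 1 + α - 1 = s - 2 + α by ring] at e2
  rw [show s + α - 1 - 1 = s - 2 + α by ring,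
    show s + α - 1 + α - 1 = s - 2 + 2 * α by ring] at e3
  push_cast at e2 e3
  linear_combination (x : ℂ) * e1 - s * e2 + α * t * e3

/-! ### Laplace transforms with complex argument -/

/-- A formula for the Laplace transform extends from the positive axis to the right half plane. -/
lemma integral_cexp_neg_mul_eq_of_forall_pos {Ω : Type*} [MeasurableSpace Ω] {μ : Measure Ω}
    {X : Ω → ℝ} (hX : ∀ l : ℝ, 0 < l → Integrable (fun o => Real.exp (-(l * X o))) μ)
    {F : ℂ → ℂ} (hF : DifferentiableOn ℂ F {z | 0 < z.re})
    (h : ∀ l : ℝ, 0 < l → ((∫ o, Real.exp (-(l * X o)) ∂μ : ℝ) : ℂ) = F l)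
    {z : ℂ} (hz : 0 < z.re) : ∫ o, Complex.exp (-(z * X o)) ∂μ = F z := by
  have hopen : IsOpen {z : ℂ | 0 < z.re} := isOpen_lt continuous_const Complex.continuous_re
  have hsub : Ioi 0 ⊆ interior (integrableExpSet (-X) μ) :=
    interior_maximal (fun l hl => by
      change Integrable (fun o => Real.exp (l * (-X) o)) μ
      simpa using hX l hl) isOpen_Ioi
  have hG : AnalyticOnNhd ℂ (complexMGF (-X) μ) {z | 0 < z.re} :=
    analyticOnNhd_complexMGF.mono fun z hz => hsub hz
  have hconn : IsPreconnected {z : ℂ | 0 < z.re} :=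
    (convex_halfSpace_re_gt 0).isPreconnected
  have htend : Tendsto (fun x : ℝ => (x : ℂ)) (𝓝[≠] 1) (𝓝[≠] ((1 : ℝ) : ℂ)) :=
    tendsto_nhdsWithin_of_tendsto_nhds_of_eventually_within _
      (Complex.continuous_ofReal.continuousAt.tendsto.mono_left nhdsWithin_le_nhds)
      (by
        filter_upwards [self_mem_nhdsWithin] with x hx
        simpa using hx)
  have hev : ∀ᶠ x : ℝ in 𝓝[≠] 1, complexMGF (-X) μ x = F x := by
    filter_upwards [nhdsWithin_le_nhds (Ioi_mem_nhds (zero_lt_one' ℝ))] with x hx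
    rw [complexMGF_ofReal, ← h x hx, mgf]
    simp
  -- Identity theorem: both sides are analytic on the half plane and agree at real points
  -- accumulating at `1`.
  have := hG.eqOn_of_preconnected_of_frequently_eq (hF.analyticOnNhd hopen) hconn
    (z₀ := ((1 : ℝ) : ℂ)) (by simp) (htend.frequently hev.frequently) hz
  rw [← this, complexMGF]
  simp

lemma differentiableOn_cpow_re_pos (c : ℂ) :
    DifferentiableOn ℂ (fun z : ℂ => z ^ c) {z | 0 < z.re} := fun _ hz =>
  (differentiableAt_id.cpow_const (Or.inl hz)).differentiableWithinAt

lemma integrableOn_rpow_mul_exp_neg_mul_Ioi {a r : ℝ} (ha : 0 < a) (hr : 0 < r) :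
    IntegrableOn (fun u : ℝ => u ^ (a - 1) * Real.exp (-(r * u))) (Ioi 0) := by
  have := integrableOn_rpow_mul_exp_neg_mul_rpow (s := a - 1) (p := 1) (b := r)
    (by linarith) one_pos hr
  simpa using this

lemma integral_rpow_mul_cexp_neg_mul_Ioi {a : ℝ} (ha : 0 < a) {z : ℂ} (hz : 0 < z.re) :
    ∫ u in Ioi (0 : ℝ), ((u ^ (a - 1) : ℝ) : ℂ) * Complex.exp (-(z * u)) =
      z ^ (-(a : ℂ)) * Real.Gamma a := by
  have hm : Measurable fun u : ℝ => ENNReal.ofReal (u ^ (a - 1)) := by fun_prop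
  have hpos : ∀ u ∈ Ioi (0 : ℝ), (ENNReal.ofReal (u ^ (a - 1))).toReal = u ^ (a - 1) :=
    fun u hu => ENNReal.toReal_ofReal (Real.rpow_nonneg (le_of_lt hu) _)
  -- This measure is infinite, but the continuation lemma only needs `e^(-lu)` to be integrable for
  -- `l > 0`.
  set μ := (volume.restrict (Ioi (0 : ℝ))).withDensity
    (fun u : ℝ => ENNReal.ofReal (u ^ (a - 1))) with hμ
  have hint : ∀ l : ℝ, 0 < l → Integrable (fun u : ℝ => Real.exp (-(l * u))) μ := by
    intro l hl
    rw [hμ, integrable_withDensity_iff_integrable_smul' hm (by simp)]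
    refine (integrableOn_rpow_mul_exp_neg_mul_Ioi ha hl).congr_fun (fun u hu => ?_)
      measurableSet_Ioi
    simp only [hpos u hu, smul_eq_mul]
  have hval : ∀ l : ℝ, 0 < l → ((∫ u, Real.exp (-(l * u)) ∂μ : ℝ) : ℂ) =
      (l : ℂ) ^ (-(a : ℂ)) * Real.Gamma a := by
    intro l hl
    rw [hμ, integral_withDensity_eq_integral_toReal_smul hm (by simp)]
    have : ∫ u in Ioi (0 : ℝ), (ENNReal.ofReal (u ^ (a - 1))).toReal • Real.exp (-(l * u)) =
        (1 / l) ^ a * Real.Gamma a := by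
      rw [← Real.integral_rpow_mul_exp_neg_mul_Ioi ha hl]
      refine setIntegral_congr_fun measurableSet_Ioi fun u hu => ?_
      simp only [hpos u hu, smul_eq_mul]
    rw [this, one_div, Real.inv_rpow hl.le, ← Real.rpow_neg hl.le]
    push_cast
    rw [Complex.ofReal_cpow hl.le]
    push_cast
    rfl
  have := integral_cexp_neg_mul_eq_of_forall_pos (μ := μ) (X := fun u => u) hint
    (F := fun z => z ^ (-(a : ℂ)) * Real.Gamma a)
    ((differentiableOn_cpow_re_pos _).mul_const _) hval hz
  rw [← this, hμ, integral_withDensity_eq_integral_toReal_smul hm (by simp)]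
  refine setIntegral_congr_fun measurableSet_Ioi fun u hu => ?_
  simp only [hpos u hu, Complex.real_smul]

/-! ### Fourier inversion on the Bromwich line -/

lemma fourierInv_bromwich (α s x t : ℝ) :
    𝓕⁻ (fun w => Complex.exp (-(t * bromwichPoint w ^ (α : ℂ))) * bromwichPoint w ^ (s : ℂ)) x =
      Complex.exp (-x) * bromwichIntegral α s x t := by
  rw [Real.fourierInv_eq_fourier_neg, Real.fourier_real_eq_integral_exp_smul, bromwichIntegral,
    ← integral_const_mul]
  congr 1
  ext w
  rw [bromwichKernel, smul_eq_mul, ← mul_assoc, ← mul_assoc, ← Complex.exp_add, ← Complex.exp_add,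
    bromwichPoint]
  congr 2
  push_cast
  ring

/-- Fourier inversion for `u^(-p-1) e^(-u)` on `u > 0`, whose transform is `Γ(-p) z^p`. The
condition `p < -1` makes this transform integrable. -/
lemma bromwichIntegral_time_zero (α : ℝ) {p x : ℝ} (hp : p < -1) (hx : 0 < x) :
    bromwichIntegral α p x 0 = (x ^ (-p - 1) / Real.Gamma (-p) : ℝ) := by
  have ha : 0 < -p := by linarith
  have hΓ := Real.Gamma_pos_of_pos ha
  set f : ℝ → ℂ := (Ioi (0 : ℝ)).indicator fun u => ((u ^ (-p - 1) * Real.exp (-(1 * u)) : ℝ) : ℂ)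
    with hf
  have hfi : Integrable f := by
    rw [hf, integrable_indicator_iff measurableSet_Ioi]
    exact (integrableOn_rpow_mul_exp_neg_mul_Ioi ha one_pos).ofReal
  have hFf : 𝓕 f = fun w => (Real.Gamma (-p) : ℂ) *
      (Complex.exp (-((0 : ℝ) * bromwichPoint w ^ (α : ℂ))) * bromwichPoint w ^ (p : ℂ)) := by
    ext w
    rw [Real.fourier_real_eq_integral_exp_smul]
    have h := integral_rpow_mul_cexp_neg_mul_Ioi ha (z := bromwichPoint w)
      (by simp [bromwichPoint_re])
    rw [show (-((-p : ℝ) : ℂ)) = p by push_cast; ring] at h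
    simp only [Complex.ofReal_zero, zero_mul, neg_zero, Complex.exp_zero, one_mul]
    rw [mul_comm _ (bromwichPoint w ^ (p : ℂ)), ← h, ← integral_indicator measurableSet_Ioi]
    congr 1
    ext u
    by_cases hu : u ∈ Ioi (0 : ℝ)
    · simp only [hf, indicator_of_mem hu, smul_eq_mul]
      push_cast
      rw [mul_left_comm, ← Complex.exp_add, bromwichPoint]
      congr 2
      ring
    · simp [hf, indicator_of_notMem hu]
  have hFi : Integrable (𝓕 f) := by
    rw [hFf]
    refine Integrable.const_mul ?_ _
    refine (integrable_norm_bromwichPoint_rpow hp).mono' ?_ (Eventually.of_forall fun w => ?_)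
    · simp only [Complex.ofReal_zero, zero_mul, neg_zero, Complex.exp_zero, one_mul]
      exact (continuous_bromwichPoint_cpow _).aestronglyMeasurable
    · simp [Complex.norm_cpow_real]
  have hcont : ContinuousAt f x := by
    have : f =ᶠ[𝓝 x] fun u => ((u ^ (-p - 1) * Real.exp (-(1 * u)) : ℝ) : ℂ) := by
      filter_upwards [Ioi_mem_nhds hx] with u hu
      rw [hf, indicator_of_mem hu]
    refine ContinuousAt.congr ?_ this.symm
    refine Complex.continuous_ofReal.continuousAt.comp ?_
    exact (Real.continuousAt_rpow_const x _ (Or.inl hx.ne')).mul (by fun_prop)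
  have hinv := hfi.fourierInv_fourier_eq hFi hcont
  rw [hFf, Real.fourierInv_eq_fourier_neg, Real.fourier_real_eq_integral_exp_smul] at hinv
  have hinv2 := fourierInv_bromwich α p x 0
  rw [Real.fourierInv_eq_fourier_neg, Real.fourier_real_eq_integral_exp_smul] at hinv2
  simp only [smul_eq_mul, mul_left_comm _ (Real.Gamma (-p) : ℂ)] at hinv hinv2
  rw [integral_const_mul, hinv2, hf, indicator_of_mem (mem_Ioi.2 hx)] at hinv
  have hexp : Complex.exp (-x) ≠ 0 := Complex.exp_ne_zero _
  have hΓ' : (Real.Gamma (-p) : ℂ) ≠ 0 := by exact_mod_cast hΓ.ne'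
  push_cast at hinv ⊢
  rw [one_mul] at hinv
  rw [eq_div_iff hΓ']
  apply mul_left_cancel₀ hexp
  linear_combination hinv

lemma conj_bromwichPoint (w : ℝ) : (starRingEnd ℂ) (bromwichPoint w) = bromwichPoint (-w) := by
  simp [bromwichPoint, Complex.ext_iff]

lemma conj_bromwichPoint_cpow (s w : ℝ) :
    (starRingEnd ℂ) (bromwichPoint w ^ (s : ℂ)) = bromwichPoint (-w) ^ (s : ℂ) := by
  have harg : (bromwichPoint (-w)).arg ≠ Real.pi :=
    Complex.slitPlane_arg_ne_pi (bromwichPoint_mem_slitPlane (-w))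
  have h := Complex.cpow_conj (bromwichPoint (-w)) s harg
  rw [Complex.conj_ofReal, conj_bromwichPoint, neg_neg] at h
  exact h.symm

/-- Conjugating the kernel amounts to replacing `w` by `-w`. -/
lemma bromwichIntegral_im (α s x t : ℝ) : (bromwichIntegral α s x t).im = 0 := by
  rw [← Complex.conj_eq_iff_im, bromwichIntegral, ← integral_conj,
    ← integral_neg_eq_self (bromwichKernel α s x t)]
  congr 1
  ext w
  simp only [bromwichKernel, map_mul, ← Complex.exp_conj, map_sub, conj_bromwichPoint,
    conj_bromwichPoint_cpow, Complex.conj_ofReal]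

lemma ofReal_re_bromwichIntegral (α s x t : ℝ) :
    ((bromwichIntegral α s x t).re : ℂ) = bromwichIntegral α s x t :=
  Complex.ext rfl (by simp [bromwichIntegral_im])

/-! ### The density -/

/-- Every `B_s` is `O(e^x)`, and so is `x² B_s` by the double integration by parts; hence `e^(-x)
B_s = O(1/(1+x²))`. -/
lemma integrable_exp_neg_mul_bromwichIntegral {α : ℝ} (h0 : 0 < α) (h1 : α < 1) (s : ℝ) {t : ℝ}
    (ht : 0 < t) :
    Integrable fun x : ℝ => Real.exp (-x) * (bromwichIntegral α s x t).re := by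
  have hcont : Continuous fun x : ℝ => (bromwichIntegral α s x t).re :=
    continuous_iff_continuousAt.2 fun x =>
      Complex.continuous_re.continuousAt.comp
        (hasDerivAt_bromwichIntegral_space h0 h1 s x ht).continuousAt
  obtain ⟨C, hC0, hC⟩ := exists_norm_bromwichIntegral_le h0 h1 s ht
  obtain ⟨C₁, hC₁0, hC₁⟩ := exists_norm_bromwichIntegral_le h0 h1 (s - 2) ht
  obtain ⟨C₂, hC₂0, hC₂⟩ := exists_norm_bromwichIntegral_le h0 h1 (s - 2 + α) ht
  obtain ⟨C₃, hC₃0, hC₃⟩ := exists_norm_bromwichIntegral_le h0 h1 (s - 2 + 2 * α) ht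
  set D := C + (|s * (s - 1)| * C₁ + |α * (2 * s + α - 1) * t| * C₂ + |α ^ 2 * t ^ 2| * C₃)
    with hD
  refine (integrable_inv_one_add_sq.const_mul D).mono'
    ((Real.continuous_exp.comp continuous_neg).mul hcont).aestronglyMeasurable
    (Eventually.of_forall fun x => ?_)
  rw [← div_eq_mul_inv, le_div_iff₀ (by positivity), norm_mul,
    Real.norm_of_nonneg (Real.exp_pos _).le]
  have hre : ‖(bromwichIntegral α s x t).re‖ ≤ ‖bromwichIntegral α s x t‖ :=
    Complex.abs_re_le_norm _
  have hsq : x ^ 2 * ‖bromwichIntegral α s x t‖ ≤ Real.exp x *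
      (|s * (s - 1)| * C₁ + |α * (2 * s + α - 1) * t| * C₂ + |α ^ 2 * t ^ 2| * C₃) := by
    have e : ‖(x : ℂ) ^ 2 * bromwichIntegral α s x t‖ = x ^ 2 * ‖bromwichIntegral α s x t‖ := by
      simp
    rw [← e, sq_mul_bromwichIntegral h0 h1 s x ht]
    have nr : ∀ (a : ℝ) (b : ℂ), ‖(a : ℂ) * b‖ = |a| * ‖b‖ := fun a b => by simp
    have e1 : ‖(s * (s - 1) * bromwichIntegral α (s - 2) x t : ℂ)‖ =
        |s * (s - 1)| * ‖bromwichIntegral α (s - 2) x t‖ := by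
      rw [← nr]; push_cast; rfl
    have e2 : ‖(α * (2 * s + α - 1) * (t * bromwichIntegral α (s - 2 + α) x t) : ℂ)‖ =
        |α * (2 * s + α - 1) * t| * ‖bromwichIntegral α (s - 2 + α) x t‖ := by
      rw [← mul_assoc, ← nr]; push_cast; rfl
    have e3 : ‖(α ^ 2 * (t ^ 2 * bromwichIntegral α (s - 2 + 2 * α) x t) : ℂ)‖ =
        |α ^ 2 * t ^ 2| * ‖bromwichIntegral α (s - 2 + 2 * α) x t‖ := by
      rw [← mul_assoc, ← nr]; push_cast; rfl
    refine (norm_add_le _ _).trans ((add_le_add_left (norm_sub_le _ _) _).trans ?_)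
    rw [e1, e2, e3]
    have i1 := mul_le_mul_of_nonneg_left (hC₁ x) (abs_nonneg (s * (s - 1)))
    have i2 := mul_le_mul_of_nonneg_left (hC₂ x) (abs_nonneg (α * (2 * s + α - 1) * t))
    have i3 := mul_le_mul_of_nonneg_left (hC₃ x) (abs_nonneg (α ^ 2 * t ^ 2))
    linarith
  have h4 : (1 + x ^ 2) * ‖bromwichIntegral α s x t‖ ≤ Real.exp x * D := by
    rw [hD]; linarith [hC x]
  calc Real.exp (-x) * ‖(bromwichIntegral α s x t).re‖ * (1 + x ^ 2)
      ≤ Real.exp (-x) * ‖bromwichIntegral α s x t‖ * (1 + x ^ 2) := by gcongr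
    _ = Real.exp (-x) * ((1 + x ^ 2) * ‖bromwichIntegral α s x t‖) := by ring
    _ ≤ Real.exp (-x) * (Real.exp x * D) := by gcongr
    _ = D := by rw [← mul_assoc, ← Real.exp_add]; simp

/-- A finite measure whose characteristic function is that of a continuous integrable function
has this function as its density. -/
lemma nonneg_and_eq_withDensity_of_charFun_eq {ρ : Measure ℝ} [IsFiniteMeasure ρ] {k : ℝ → ℝ}
    (hk : Continuous k) (hki : Integrable k)
    (h : ∀ r : ℝ, charFun ρ r = ∫ x : ℝ, (k x : ℂ) * Complex.exp (r * x * Complex.I)) :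
    (∀ x, 0 ≤ k x) ∧ ρ = volume.withDensity fun x => ENNReal.ofReal (k x) := by
  have hmp : Measurable fun x => ENNReal.ofReal (k x) := hk.measurable.ennreal_ofReal
  have hmn : Measurable fun x => ENNReal.ofReal (-k x) := hk.measurable.neg.ennreal_ofReal
  have fp : IsFiniteMeasure (volume.withDensity fun x => ENNReal.ofReal (k x)) :=
    isFiniteMeasure_withDensity_ofReal hki.2
  have fn : IsFiniteMeasure (volume.withDensity fun x => ENNReal.ofReal (-k x)) :=
    isFiniteMeasure_withDensity_ofReal hki.neg.2
  have hint : ∀ (μ : Measure ℝ) [IsFiniteMeasure μ] (r : ℝ),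
      Integrable (fun x : ℝ => Complex.exp (r * x * Complex.I)) μ := by
    intro μ _ r
    refine (integrable_const (1 : ℝ)).mono' (by fun_prop) (Eventually.of_forall fun x => ?_)
    rw [← Complex.ofReal_mul, Complex.norm_exp_ofReal_mul_I]
  have hmi : ∀ (m : ℝ → ℝ), Integrable m → ∀ r : ℝ,
      Integrable fun x : ℝ => (m x : ℂ) * Complex.exp (r * x * Complex.I) := by
    intro m hm r
    refine hm.norm.mono' (hm.ofReal.aestronglyMeasurable.mul (by fun_prop))
      (Eventually.of_forall fun x => ?_)
    rw [norm_mul, ← Complex.ofReal_mul, Complex.norm_exp_ofReal_mul_I]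
    simp
  -- The sign of `k` is not known yet, so its negative part is moved to the other side, where
  -- uniqueness applies to two finite positive measures.
  have hsum : ρ + volume.withDensity (fun x => ENNReal.ofReal (-k x)) =
      volume.withDensity fun x => ENNReal.ofReal (k x) := by
    refine Measure.ext_of_charFun (funext fun r => ?_)
    rw [charFun_apply_real, integral_add_measure (hint _ r) (hint _ r), ← charFun_apply_real, h,
      charFun_apply_real, integral_withDensity_eq_integral_toReal_smul hmn (by simp),
      integral_withDensity_eq_integral_toReal_smul hmp (by simp)]
    simp only [ENNReal.toReal_ofReal', Complex.real_smul]
    refine (integral_add (hmi k hki r) (hmi _ hki.neg.pos_part r)).symm.trans ?_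
    congr 1
    ext x
    simp only [Pi.neg_apply]
    rw [← add_mul, ← Complex.ofReal_add]
    congr 2
    rcases le_total (k x) 0 with hx | hx
    · rw [max_eq_left (by simpa using hx), max_eq_right hx]; simp
    · rw [max_eq_right (by simpa using hx), max_eq_left hx]; simp
  have hU : IsOpen {x | k x < 0} := isOpen_lt hk continuous_const
  have hzero : (volume.withDensity fun x => ENNReal.ofReal (-k x)) {x | k x < 0} = 0 := by
    have h1 : (volume.withDensity fun x => ENNReal.ofReal (k x)) {x | k x < 0} = 0 := by
      rw [withDensity_apply_eq_zero hmp]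
      convert measure_empty (μ := (volume : Measure ℝ))
      ext x
      simp only [mem_inter_iff, mem_ofPred_eq, mem_empty_iff_false, iff_false, not_and, not_lt]
      intro hx
      by_contra hx'
      exact hx (ENNReal.ofReal_of_nonpos (not_le.1 hx').le)
    rw [← hsum, Measure.add_apply] at h1
    exact (add_eq_zero.1 h1).2
  -- The open set `{k < 0}` is Lebesgue-null, hence empty.
  have hnn : ∀ x, 0 ≤ k x := by
    rw [withDensity_apply_eq_zero hmn] at hzero
    have hset : {x | ENNReal.ofReal (-k x) ≠ 0} ∩ {x | k x < 0} = {x | k x < 0} := by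
      refine inter_eq_right.2 fun x hx => ?_
      simpa using hx
    rw [hset, hU.measure_eq_zero_iff volume] at hzero
    intro x
    by_contra hx
    have : x ∈ {x | k x < 0} := not_le.1 hx
    rw [hzero] at this
    exact this
  refine ⟨hnn, ?_⟩
  have hz : (volume.withDensity fun x => ENNReal.ofReal (-k x)) = 0 := by
    have : (fun x => ENNReal.ofReal (-k x)) = 0 := by
      ext x
      simpa using hnn x
    rw [this, withDensity_zero]
  rw [← hsum, hz, add_zero]

lemma integral_exp_neg_mul_bromwichIntegral_mul_cexp {α : ℝ} (h0 : 0 < α) (h1 : α < 1) {t : ℝ}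
    (ht : 0 < t) (w : ℝ) :
    ∫ x : ℝ, ((Real.exp (-x) * (bromwichIntegral α 0 x t).re : ℝ) : ℂ) *
      Complex.exp (((-2 * Real.pi * w : ℝ) : ℂ) * x * Complex.I) =
    Complex.exp (-(t * bromwichPoint w ^ (α : ℂ))) := by
  set g : ℝ → ℂ := fun w => Complex.exp (-(t * bromwichPoint w ^ (α : ℂ))) *
    bromwichPoint w ^ ((0 : ℝ) : ℂ) with hg
  have hgk : g = bromwichKernel α 0 0 t := by
    ext w; simp [hg, bromwichKernel]
  have hgc : Continuous g := hgk ▸ continuous_bromwichKernel_right α 0 0 t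
  have hgi : Integrable g := hgk ▸ integrable_bromwichKernel h0 h1 0 0 ht
  have hinv : 𝓕⁻ g = fun x : ℝ => ((Real.exp (-x) * (bromwichIntegral α 0 x t).re : ℝ) : ℂ) := by
    ext x
    rw [hg, fourierInv_bromwich, Complex.ofReal_mul, ofReal_re_bromwichIntegral]
    push_cast
    rfl
  have hinvi : Integrable (𝓕⁻ g) := by
    rw [hinv]
    exact (integrable_exp_neg_mul_bromwichIntegral h0 h1 0 ht).ofReal
  -- `𝓕 g` is the reflection of `𝓕⁻ g`.
  have hFi : Integrable (𝓕 g) := by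
    have := hinvi.comp_neg
    simpa only [Real.fourierInv_eq_fourier_neg, neg_neg] using this
  have := congrFun (hgc.fourier_fourierInv_eq hgi hFi) w
  rw [hinv, Real.fourier_real_eq_integral_exp_smul] at this
  simp only [hg, Complex.ofReal_zero, Complex.cpow_zero, mul_one] at this
  rw [← this]
  congr 1
  ext x
  rw [smul_eq_mul, mul_comm]
  congr 2
  push_cast
  ring

/-- The law with Laplace transform `exp (-t l ^ α)` has the Bromwich integral as its density. -/
lemma eq_withDensity_bromwichIntegral {α : ℝ} (h0 : 0 < α) (h1 : α < 1) {t : ℝ} (ht : 0 < t)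
    {μ : Measure ℝ} [IsFiniteMeasure μ] (hμ : ∀ᵐ x ∂μ, 0 ≤ x)
    (hL : ∀ l : ℝ, 0 < l → ∫ x, Real.exp (-(l * x)) ∂μ = Real.exp (-(t * l ^ α))) :
    (∀ x, 0 ≤ (bromwichIntegral α 0 x t).re) ∧
    (∀ x ≤ 0, (bromwichIntegral α 0 x t).re = 0) ∧
    μ = volume.withDensity fun x => ENNReal.ofReal (bromwichIntegral α 0 x t).re := by
  set h : ℝ → ℝ := fun x => (bromwichIntegral α 0 x t).re with hh
  have hcont : Continuous h := continuous_iff_continuousAt.2 fun x =>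
    Complex.continuous_re.continuousAt.comp
      (hasDerivAt_bromwichIntegral_space h0 h1 0 x ht).continuousAt
  have hint : ∀ l : ℝ, 0 < l → Integrable (fun x : ℝ => Real.exp (-(l * x))) μ := by
    intro l hl
    refine (integrable_const (1 : ℝ)).mono' (by fun_prop) ?_
    filter_upwards [hμ] with x hx
    rw [Real.norm_of_nonneg (Real.exp_pos _).le, Real.exp_le_one_iff]
    nlinarith
  have hcL : ∀ z : ℂ, 0 < z.re →
      ∫ x, Complex.exp (-(z * (x : ℝ))) ∂μ = Complex.exp (-(t * z ^ (α : ℂ))) := fun z hz =>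
    integral_cexp_neg_mul_eq_of_forall_pos (X := fun x => x) hint
      (F := fun z => Complex.exp (-(t * z ^ (α : ℂ))))
      (((differentiableOn_cpow_re_pos _).const_mul _).neg.cexp)
      (fun l hl => by
        rw [hL l hl]
        push_cast
        rw [Complex.ofReal_cpow hl.le]) hz
  have hm : Measurable fun x : ℝ => ENNReal.ofReal (Real.exp (-x)) := by fun_prop
  have hm' : Measurable fun x : ℝ => ENNReal.ofReal (Real.exp x) := by fun_prop
  -- The tilt moves the Laplace transform of `μ` on `Re z = 1` to the characteristic function of
  -- `ρ`; frequency `r` corresponds to `w = -r/(2π)`.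
  set ρ := μ.withDensity fun x => ENNReal.ofReal (Real.exp (-x)) with hρ
  have : IsFiniteMeasure ρ := isFiniteMeasure_withDensity_ofReal (by
    have := (hint 1 one_pos).2
    simpa using this)
  obtain ⟨hnn, hρe⟩ := nonneg_and_eq_withDensity_of_charFun_eq (ρ := ρ)
    (k := fun x => Real.exp (-x) * h x) ((Real.continuous_exp.comp continuous_neg).mul hcont)
    (integrable_exp_neg_mul_bromwichIntegral h0 h1 0 ht) (by
      intro r
      have hr : r = -2 * Real.pi * (-r / (2 * Real.pi)) := by
        field_simp [Real.pi_ne_zero]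
      have e := integral_exp_neg_mul_bromwichIntegral_mul_cexp h0 h1 ht (-r / (2 * Real.pi))
      rw [← hr] at e
      rw [e, ← hcL _ (by simp [bromwichPoint_re]), charFun_apply_real, hρ,
        integral_withDensity_eq_integral_toReal_smul hm (by simp)]
      congr 1
      ext x
      rw [ENNReal.toReal_ofReal (Real.exp_pos _).le, Complex.real_smul, Complex.ofReal_exp,
        ← Complex.exp_add, bromwichPoint]
      congr 1
      have hpi : (Real.pi : ℂ) ≠ 0 := by exact_mod_cast Real.pi_ne_zero
      push_cast
      field_simp
      ring)
  have hnn' : ∀ x, 0 ≤ h x := fun x => by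
    have := hnn x
    exact nonneg_of_mul_nonneg_right this (Real.exp_pos _)
  have hμe : μ = volume.withDensity fun x => ENNReal.ofReal (h x) := by
    have e1 : ρ.withDensity (fun x => ENNReal.ofReal (Real.exp x)) = μ := by
      rw [hρ, ← withDensity_mul _ hm hm']
      convert withDensity_one (μ := μ) using 2
      ext x
      simp only [Pi.mul_apply, Pi.one_apply]
      rw [← ENNReal.ofReal_mul (Real.exp_pos _).le, ← Real.exp_add]
      simp
    rw [← e1, hρe, ← withDensity_mul _ (by fun_prop) hm']
    congr 1
    ext x
    simp only [Pi.mul_apply]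
    rw [← ENNReal.ofReal_mul (hnn x), mul_right_comm, ← Real.exp_add]
    simp
  -- `μ` does not charge `x < 0`, so the open set where `h > 0` there is null, hence empty;
  -- continuity then covers `x = 0`.
  have hneg : ∀ x < 0, h x = 0 := by
    have hz : μ (Iio 0) = 0 := by
      rw [ae_iff] at hμ
      simpa [Iio] using hμ
    rw [hμe, withDensity_apply_eq_zero (by fun_prop)] at hz
    have hset : {x | ENNReal.ofReal (h x) ≠ 0} ∩ Iio 0 = {x | 0 < h x} ∩ Iio 0 := by
      ext x; simp
    rw [hset, ((isOpen_lt continuous_const hcont).inter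
      isOpen_Iio).measure_eq_zero_iff volume] at hz
    intro x hx
    by_contra hne
    have : x ∈ {x | 0 < h x} ∩ Iio 0 := ⟨lt_of_le_of_ne (hnn' x) (Ne.symm hne), hx⟩
    rw [hz] at this
    exact this
  refine ⟨hnn', fun x hx => ?_, hμe⟩
  have hcl : closure (Iio (0 : ℝ)) ⊆ {x | h x = 0} :=
    closure_minimal hneg (isClosed_eq hcont continuous_const)
  rw [closure_Iio] at hcl
  exact hcl hx

/-! ### Small times -/

/-- Dominated convergence with a bound uniform in `t`. The factor `0^j` keeps the term `j = 0` and
kills the others. -/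
lemma tendsto_pow_mul_bromwichIntegral {α : ℝ} (h0 : 0 < α) (h1 : α < 1) {p : ℝ} (hp : p < -1)
    (x : ℝ) (j : ℕ) :
    Tendsto (fun t : ℝ => (t : ℂ) ^ j * bromwichIntegral α (p + j * α) x t) (𝓝[>] 0)
      (𝓝 ((0 : ℂ) ^ j * bromwichIntegral α (p + j * α) x 0)) := by
  simp only [bromwichIntegral, ← integral_const_mul]
  refine tendsto_integral_filter_of_dominated_convergence
    (fun w => Real.exp x * (j.factorial / Real.cos (α * (Real.pi / 2)) ^ j) *
      ‖bromwichPoint w‖ ^ p) (Eventually.of_forall fun t => ?_) ?_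
    ((integrable_norm_bromwichPoint_rpow hp).const_mul _) (Eventually.of_forall fun w => ?_)
  · exact (continuous_const.mul (continuous_bromwichKernel_right α _ x t)).aestronglyMeasurable
  · filter_upwards [self_mem_nhdsWithin] with t ht
    refine Eventually.of_forall fun w => ?_
    have ht' : (0 : ℝ) ≤ t := le_of_lt ht
    rw [norm_mul, norm_pow, Complex.norm_real, Real.norm_of_nonneg ht']
    exact pow_mul_norm_bromwichKernel_le h0 h1 p x w j ht'
  · have hc : Continuous fun t : ℝ => (t : ℂ) ^ j * bromwichKernel α (p + j * α) x t w :=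
      (Complex.continuous_ofReal.pow j).mul (continuous_iff_continuousAt.2 fun t =>
        (hasDerivAt_bromwichKernel_time α _ x t w).continuousAt)
    simpa using (hc.tendsto 0).mono_left nhdsWithin_le_nhds

lemma tendsto_bromwichIntegral_time_zero {α : ℝ} (h0 : 0 < α) (h1 : α < 1) {s : ℝ} (hs0 : 0 < s)
    (hs1 : s < 1) {x : ℝ} (hx : 0 < x) :
    Tendsto (fun t : ℝ => (bromwichIntegral α s x t).re) (𝓝[>] 0)
      (𝓝 (x ^ (-s - 1) / Real.Gamma (-s))) := by
  have hp : s - 2 < -1 := by linarith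
  have l0 := tendsto_pow_mul_bromwichIntegral h0 h1 hp x 0
  have l1 := tendsto_pow_mul_bromwichIntegral h0 h1 hp x 1
  have l2 := tendsto_pow_mul_bromwichIntegral h0 h1 hp x 2
  simp only [pow_zero, Nat.cast_zero, zero_mul, add_zero, one_mul, pow_one, Nat.cast_one,
    Nat.cast_ofNat, ne_eq, OfNat.ofNat_ne_zero, not_false_eq_true, zero_pow] at l0 l1 l2
  have hlim := ((l0.const_mul ((s : ℂ) * (s - 1))).sub
    (l1.const_mul ((α : ℂ) * (2 * s + α - 1)))).add (l2.const_mul ((α : ℂ) ^ 2))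
  rw [bromwichIntegral_time_zero α hp hx, mul_zero, mul_zero, sub_zero, add_zero] at hlim
  have hlim' := hlim.const_mul ((x : ℂ) ^ 2)⁻¹
  have hx2 : (x : ℂ) ^ 2 ≠ 0 := by
    have : (x : ℂ) ≠ 0 := by exact_mod_cast hx.ne'
    positivity
  have heq : ∀ᶠ t : ℝ in 𝓝[>] 0, ((x : ℂ) ^ 2)⁻¹ *
      ((s : ℂ) * (s - 1) * bromwichIntegral α (s - 2) x t
        - α * (2 * s + α - 1) * (t * bromwichIntegral α (s - 2 + α) x t)
        + α ^ 2 * (t ^ 2 * bromwichIntegral α (s - 2 + 2 * α) x t)) =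
      bromwichIntegral α s x t := by
    filter_upwards [self_mem_nhdsWithin] with t ht
    rw [← sq_mul_bromwichIntegral h0 h1 s x ht, inv_mul_cancel_left₀ hx2]
  have hre : Tendsto (fun t : ℝ => (bromwichIntegral α s x t).re) (𝓝[>] 0) _ :=
    (Complex.continuous_re.tendsto _).comp (hlim'.congr' heq)
  convert hre using 2
  -- The factor `s(s-1)` from the integrations by parts cancels through `Γ(2-s) = s(s-1) Γ(-s)`.
  have hΓ1 : Real.Gamma (1 - s) = -s * Real.Gamma (-s) := by
    rw [← Real.Gamma_add_one (by linarith)]; congr 1; ring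
  have hΓ2 : Real.Gamma (-(s - 2)) = (1 - s) * Real.Gamma (1 - s) := by
    rw [← Real.Gamma_add_one (by linarith)]; congr 1; ring
  have hΓ : Real.Gamma (-s) ≠ 0 := by
    have := (Real.Gamma_pos_of_pos (show 0 < 1 - s by linarith)).ne'
    rw [hΓ1] at this
    exact right_ne_zero_of_mul this
  have hpow : x ^ (-(s - 2) - 1) = x ^ 2 * x ^ (-s - 1) := by
    rw [← Real.rpow_natCast x 2, ← Real.rpow_add hx]; congr 1; push_cast; ring
  have hreal : ((x : ℂ) ^ 2)⁻¹ * ((s : ℂ) * (s - 1) *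
      ((x ^ (-(s - 2) - 1) / Real.Gamma (-(s - 2)) : ℝ) : ℂ)) =
      (((x ^ 2)⁻¹ * (s * (s - 1) * (x ^ (-(s - 2) - 1) / Real.Gamma (-(s - 2)))) : ℝ) : ℂ) := by
    push_cast; rfl
  rw [hreal, Complex.ofReal_re, hpow, hΓ2, hΓ1]
  have h1s : 1 - s ≠ 0 := by linarith
  field_simp
  ring

/-! ### Derivatives -/

lemma hasDerivAt_re_bromwichIntegral_time {α : ℝ} (h0 : 0 < α) (h1 : α < 1) (s x : ℝ) {t : ℝ}
    (ht : 0 < t) : HasDerivAt (fun t => (bromwichIntegral α s x t).re)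
      (-(bromwichIntegral α (s + α) x t).re) t := by
  simpa [Function.comp_def] using Complex.reCLM.hasFDerivAt.comp_hasDerivAt t
    (hasDerivAt_bromwichIntegral_time h0 h1 s x ht)

lemma hasDerivAt_re_bromwichIntegral_space {α : ℝ} (h0 : 0 < α) (h1 : α < 1) (s x : ℝ) {t : ℝ}
    (ht : 0 < t) : HasDerivAt (fun x => (bromwichIntegral α s x t).re)
      (bromwichIntegral α (s + 1) x t).re x := by
  simpa [Function.comp_def] using Complex.reCLM.hasFDerivAt.comp_hasDerivAt x
    (hasDerivAt_bromwichIntegral_space h0 h1 s x ht)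

lemma contDiff_one_re_bromwichIntegral_space {α : ℝ} (h0 : 0 < α) (h1 : α < 1) (s : ℝ) {t : ℝ}
    (ht : 0 < t) : ContDiff ℝ 1 fun x => (bromwichIntegral α s x t).re := by
  rw [contDiff_one_iff_deriv]
  refine ⟨fun x => (hasDerivAt_re_bromwichIntegral_space h0 h1 s x ht).differentiableAt, ?_⟩
  rw [funext fun x => (hasDerivAt_re_bromwichIntegral_space h0 h1 s x ht).deriv]
  exact continuous_iff_continuousAt.2 fun x =>
    (hasDerivAt_re_bromwichIntegral_space h0 h1 (s + 1) x ht).continuousAt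

/-- The exponent is quantified after `n` because the induction differentiates once and so shifts `s`
to `s + α`. -/
lemma contDiffOn_re_bromwichIntegral_time {α : ℝ} (h0 : 0 < α) (h1 : α < 1) (x : ℝ) (n : ℕ) :
    ∀ s : ℝ, ContDiffOn ℝ n (fun t => (bromwichIntegral α s x t).re) (Ioi 0) := by
  induction n with
  | zero =>
    intro s
    rw [Nat.cast_zero, contDiffOn_zero]
    exact fun t ht =>
      (hasDerivAt_re_bromwichIntegral_time h0 h1 s x ht).continuousAt.continuousWithinAt
  | succ n ih =>
    intro s
    rw [Nat.cast_succ, contDiffOn_succ_iff_deriv_of_isOpen isOpen_Ioi]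
    refine ⟨fun t ht => (hasDerivAt_re_bromwichIntegral_time h0 h1 s x
      ht).differentiableAt.differentiableWithinAt, fun h => by simp at h, ?_⟩
    exact (ih (s + α)).neg.congr fun t ht =>
      (hasDerivAt_re_bromwichIntegral_time h0 h1 s x ht).deriv

lemma leftDeriv_re_bromwichIntegral {α : ℝ} (h0 : 0 < α) (h1 : α < 1) (s x : ℝ) (n : ℕ) {t : ℝ}
    (ht : 0 < t) : leftDeriv n (fun t => (bromwichIntegral α s x t).re) t =
      (bromwichIntegral α (s + n * α) x t).re := by
  unfold leftDeriv
  induction n generalizing t with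
  | zero => simp
  | succ n ih =>
    have hev : iteratedDeriv n (fun t => (bromwichIntegral α s x t).re) =ᶠ[𝓝 t]
        fun t => (-1) ^ n * (bromwichIntegral α (s + n * α) x t).re := by
      filter_upwards [Ioi_mem_nhds ht] with u hu
      rw [← ih hu, ← mul_assoc, ← mul_pow]
      simp
    rw [iteratedDeriv_succ, hev.deriv_eq,
      ((hasDerivAt_re_bromwichIntegral_time h0 h1 (s + n * α) x ht).const_mul ((-1) ^ n)).deriv,
      show s + ((n + 1 : ℕ) : ℝ) * α = s + n * α + α by push_cast; ring]
    have : ((-1 : ℝ) ^ n) * (-1) ^ n = 1 := by rw [← mul_pow]; simp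
    linear_combination (bromwichIntegral α (s + n * α + α) x t).re * this

/-! ### The Riemann-Liouville integral -/

lemma bromwichKernel_sub_eq (α s x u t w : ℝ) : bromwichKernel α s (x - u) t w =
    Complex.exp (-(bromwichPoint w * u)) * bromwichKernel α s x t w := by
  rw [bromwichKernel, bromwichKernel, ← mul_assoc, ← Complex.exp_add]
  congr 2
  push_cast
  ring

/-- Translating by `u` multiplies the kernel by `e^(-zu)`; after Fubini the `u`-integral is `Γ(a)
z^(-a)`. -/
lemma integral_rpow_mul_bromwichIntegral_sub {α : ℝ} (h0 : 0 < α) (h1 : α < 1) {a : ℝ} (ha : 0 < a)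
    (s x : ℝ) {t : ℝ} (ht : 0 < t) :
    ∫ u in Ioi (0 : ℝ), ((u ^ (a - 1) : ℝ) : ℂ) * bromwichIntegral α s (x - u) t =
      Real.Gamma a * bromwichIntegral α (s - a) x t := by
  set F : ℝ → ℝ → ℂ := fun u w => ((u ^ (a - 1) : ℝ) : ℂ) * Complex.exp (-(bromwichPoint w * u)) *
    bromwichKernel α s x t w with hF
  have hint : Integrable (Function.uncurry F) ((volume.restrict (Ioi (0 : ℝ))).prod volume) := by
    have hprod := (integrableOn_rpow_mul_exp_neg_mul_Ioi ha one_pos).integrable.mul_prod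
      (integrable_bromwichKernel h0 h1 s x ht).norm
    refine hprod.mono ?_ ?_
    · have m1 : Measurable fun p : ℝ × ℝ => ((p.1 ^ (a - 1) : ℝ) : ℂ) := by fun_prop
      have m2 : Measurable fun p : ℝ × ℝ => Complex.exp (-(bromwichPoint p.2 * p.1)) :=
        (Complex.continuous_exp.comp ((continuous_bromwichPoint.comp continuous_snd).mul
          (Complex.continuous_ofReal.comp continuous_fst)).neg).measurable
      have m3 : Measurable fun p : ℝ × ℝ => bromwichKernel α s x t p.2 :=
        (continuous_bromwichKernel_right α s x t).measurable.comp measurable_snd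
      exact ((m1.mul m2).mul m3).aestronglyMeasurable
    · refine Eventually.of_forall fun p => le_of_eq ?_
      simp only [Function.uncurry, hF, norm_mul, norm_norm, Complex.norm_real, Complex.norm_exp]
      simp [Complex.mul_re, bromwichPoint_re]
  calc ∫ u in Ioi (0 : ℝ), ((u ^ (a - 1) : ℝ) : ℂ) * bromwichIntegral α s (x - u) t
      = ∫ u in Ioi (0 : ℝ), ∫ w, F u w := by
        congr 1
        ext u
        rw [bromwichIntegral, ← integral_const_mul]
        congr 1
        ext w
        rw [bromwichKernel_sub_eq, ← mul_assoc]
    _ = ∫ w, ∫ u in Ioi (0 : ℝ), F u w := integral_integral_swap hint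
    _ = ∫ w, Real.Gamma a * bromwichKernel α (s - a) x t w := by
        congr 1
        ext w
        rw [hF, integral_mul_const,
          integral_rpow_mul_cexp_neg_mul_Ioi ha (by simp [bromwichPoint_re]), bromwichKernel,
          bromwichKernel, sub_eq_add_neg s a, bromwichPoint_cpow_add]
        push_cast
        ring
    _ = _ := by rw [integral_const_mul, bromwichIntegral]

/-- Vanishing on `y ≤ 0` lets the integral over `[0, x]` be extended to the half line, where the
convolution is explicit. -/
lemma rlIntegral_re_bromwichIntegral {α : ℝ} (h0 : 0 < α) (h1 : α < 1) {a : ℝ} (ha : 0 < a)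
    (s : ℝ) {x t : ℝ} (hx : 0 ≤ x) (ht : 0 < t)
    (hvan : ∀ y ≤ 0, (bromwichIntegral α s y t).re = 0) :
    rlIntegral a (fun y => (bromwichIntegral α s y t).re) x =
      (bromwichIntegral α (s - a) x t).re := by
  have e1 : ∫ y in (0 : ℝ)..x, (x - y) ^ (a - 1) * (bromwichIntegral α s y t).re =
      ∫ u in Ioi (0 : ℝ), u ^ (a - 1) * (bromwichIntegral α s (x - u) t).re := by
    have := intervalIntegral.integral_comp_sub_left (a := 0) (b := x)
      (fun u => u ^ (a - 1) * (bromwichIntegral α s (x - u) t).re) x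
    simp only [sub_sub_cancel, sub_self, sub_zero] at this
    rw [this, intervalIntegral.integral_of_le hx]
    refine (setIntegral_eq_of_subset_of_forall_sdiff_eq_zero measurableSet_Ioi
      Ioc_subset_Ioi_self fun u hu => ?_).symm
    have : x < u := by
      by_contra hle
      exact hu.2 ⟨hu.1, not_lt.1 hle⟩
    rw [hvan _ (by linarith), mul_zero]
  have e2 : ((∫ u in Ioi (0 : ℝ), u ^ (a - 1) * (bromwichIntegral α s (x - u) t).re : ℝ) : ℂ) =
      Real.Gamma a * bromwichIntegral α (s - a) x t := by
    rw [← integral_rpow_mul_bromwichIntegral_sub h0 h1 ha s x ht, ← integral_complex_ofReal]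
    congr 1
    ext u
    rw [Complex.ofReal_mul, ofReal_re_bromwichIntegral]
  rw [← ofReal_re_bromwichIntegral α (s - a), ← Complex.ofReal_mul, Complex.ofReal_inj] at e2
  rw [rlIntegral, e1, e2, one_div, inv_mul_cancel_left₀ (Real.Gamma_pos_of_pos ha).ne']

lemma natCeil_eq_one {ν : ℝ} (h0 : 0 < ν) (h1 : ν ≤ 1) : ⌈ν⌉₊ = 1 := by
  rw [Nat.ceil_eq_iff one_ne_zero]
  simpa using ⟨h0, h1⟩

lemma rlDifferentiableAt_and_rlDeriv_re_bromwichIntegral {α ν : ℝ} (h0 : 0 < α) (h1 : α < 1)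
    (hν0 : 0 < ν) (hν1 : ν ≤ 1) (s : ℝ) {x t : ℝ} (hx : 0 < x) (ht : 0 < t)
    (hvan : ∀ y ≤ 0, (bromwichIntegral α s y t).re = 0) :
    RLDifferentiableAt ν (fun y => (bromwichIntegral α s y t).re) x ∧
    rlDeriv ν (fun y => (bromwichIntegral α s y t).re) x = (bromwichIntegral α (s + ν) x t).re := by
  unfold RLDifferentiableAt rlDeriv
  rw [natCeil_eq_one hν0 hν1]
  simp only [Nat.cast_one, iteratedDeriv_one]
  rcases eq_or_ne 1 ν with rfl | hne
  · simp only [if_true]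
    exact ⟨(contDiff_one_re_bromwichIntegral_space h0 h1 s ht).contDiffAt,
      (hasDerivAt_re_bromwichIntegral_space h0 h1 s x ht).deriv⟩
  · simp only [if_neg hne]
    have ha : 0 < 1 - ν := by
      have := lt_of_le_of_ne hν1 hne.symm
      linarith
    have hev : rlIntegral (1 - ν) (fun y => (bromwichIntegral α s y t).re) =ᶠ[𝓝 x]
        fun y => (bromwichIntegral α (s - (1 - ν)) y t).re := by
      filter_upwards [Ioi_mem_nhds hx] with y hy
      exact rlIntegral_re_bromwichIntegral h0 h1 ha s (le_of_lt hy) ht hvan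
    refine ⟨⟨Eventually.of_forall fun y => ?_, ?_⟩, ?_⟩
    · have hi : IntervalIntegrable (fun u : ℝ => u ^ (1 - ν - 1)) volume (y - 0) (y - y) :=
        intervalIntegral.intervalIntegrable_rpow' (by linarith)
      have := (hi.comp_sub_left y)
      simp only [sub_zero, sub_self] at this
      exact this.mul_continuousOn
        (contDiff_one_re_bromwichIntegral_space h0 h1 s ht).continuous.continuousOn
    · exact (contDiff_one_re_bromwichIntegral_space h0 h1 _ ht).contDiffAt.congr_of_eventuallyEq hev
    · rw [hev.deriv_eq, (hasDerivAt_re_bromwichIntegral_space h0 h1 _ x ht).deriv]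
      congr 2
      ring

/-! ### Laws of a stable subordinator -/

section Subordinator

variable {Ω : Type*} [MeasurableSpace Ω] {P : Measure Ω} {α : ℝ} {X : ℝ≥0 → Ω → ℝ}

lemma IsStableSubordinator.isProbabilityMeasure_timeLaw [IsProbabilityMeasure P]
    (hX : IsStableSubordinator P α X) (t : ℝ) : IsProbabilityMeasure (timeLaw P X t) :=
  Measure.isProbabilityMeasure_map (hX.measurable _).aemeasurable

lemma IsStableSubordinator.ae_nonneg (hX : IsStableSubordinator P α X) (t : ℝ≥0) :
    ∀ᵐ w ∂P, 0 ≤ X t w := by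
  filter_upwards [hX.start, hX.paths] with w h0 hp
  rw [← h0]
  exact hp.1 zero_le

lemma IsStableSubordinator.ae_timeLaw_nonneg (hX : IsStableSubordinator P α X) (t : ℝ) :
    ∀ᵐ x ∂(timeLaw P X t), 0 ≤ x :=
  (ae_map_iff (hX.measurable _).aemeasurable measurableSet_Ici).2 (hX.ae_nonneg _)

lemma IsStableSubordinator.integral_timeLaw_exp_neg (hX : IsStableSubordinator P α X) {t : ℝ}
    (ht : 0 ≤ t) {l : ℝ} (hl : 0 < l) :
    ∫ x, Real.exp (-(l * x)) ∂(timeLaw P X t) = Real.exp (-(t * l ^ α)) := by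
  rw [timeLaw, integral_map (hX.measurable _).aemeasurable
    (by fun_prop : Continuous fun x : ℝ => Real.exp (-(l * x))).aestronglyMeasurable,
    hX.laplace _ l hl, Real.coe_toNNReal t ht]

/-- Right continuity of the paths at `0` and bounded convergence; no density is involved, so both
cases use it. -/
lemma IsStableSubordinator.tendsto_integral_timeLaw [IsProbabilityMeasure P]
    (hX : IsStableSubordinator P α X) (φ : ℝ →ᵇ ℝ) :
    Tendsto (fun t => ∫ x, φ x ∂(timeLaw P X t)) (𝓝[>] 0) (𝓝 (φ 0)) := by
  have hmap : ∀ t, ∫ x, φ x ∂(timeLaw P X t) = ∫ w, φ (X t.toNNReal w) ∂P := fun t =>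
    integral_map (hX.measurable _).aemeasurable φ.continuous.aestronglyMeasurable
  simp only [hmap]
  have hconst : φ 0 = ∫ _, φ 0 ∂P := by simp
  rw [hconst]
  refine tendsto_integral_filter_of_dominated_convergence (fun _ => ‖φ‖)
    (Eventually.of_forall fun t =>
      (φ.continuous.measurable.comp (hX.measurable _)).aestronglyMeasurable)
    (Eventually.of_forall fun t => Eventually.of_forall fun w => φ.norm_coe_le_norm _)
    (integrable_const _) ?_
  filter_upwards [hX.start, hX.paths] with w h0 hp
  have hc := hp.2 0
  rw [ContinuousWithinAt, h0] at hc
  have ht : Tendsto Real.toNNReal (𝓝[>] 0) (𝓝[Ici 0] 0) :=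
    tendsto_nhdsWithin_of_tendsto_nhds_of_eventually_within _
      (by simpa using (continuous_real_toNNReal.tendsto 0).mono_left nhdsWithin_le_nhds)
      (Eventually.of_forall fun t => mem_Ici.2 zero_le)
  exact (φ.continuous.tendsto 0).comp (hc.comp ht)

lemma integral_Ioi_exp_neg_mul_mul_exp_neg_mul {l c : ℝ} (hl : 0 < l) (hc : 0 < c) :
    ∫ t in Ioi (0 : ℝ), Real.exp (-(l * t)) * Real.exp (-(t * c)) = 1 / (l + c) := by
  have h := integral_exp_mul_Ioi (a := -(l + c)) (by linarith) 0
  rw [mul_zero, Real.exp_zero, neg_div_neg_eq] at h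
  rw [← h]
  congr 1
  ext t
  rw [← Real.exp_add]
  ring_nf

/-- The Laplace transform at `1` and `2` gives the first two moments of `Y = e^(-X_t)`, and its
variance is zero. -/
lemma IsStableSubordinator.timeLaw_eq_dirac [IsProbabilityMeasure P]
    (hX : IsStableSubordinator P 1 X) {t : ℝ} (ht : 0 ≤ t) : timeLaw P X t = Measure.dirac t := by
  set Y : Ω → ℝ := fun w => Real.exp (-(1 * X t.toNNReal w)) with hY
  have hY1 : ∫ w, Y w ∂P = Real.exp (-t) := by
    simpa [hY, ht] using hX.laplace t.toNNReal 1 one_pos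
  have hY2 : ∫ w, Y w ^ 2 ∂P = Real.exp (-t) ^ 2 := by
    have := hX.laplace t.toNNReal 2 two_pos
    rw [Real.rpow_one, Real.coe_toNNReal t ht] at this
    rw [← Real.exp_nat_mul]
    simp only [hY, ← Real.exp_nat_mul]
    convert this using 2
    · ext w
      congr 1
      push_cast
      ring
    · push_cast
      ring
  -- A non-integrable function would have integral `0` by convention.
  have i1 : Integrable Y P := Integrable.of_integral_ne_zero (by rw [hY1]; positivity)
  have i2 : Integrable (fun w => Y w ^ 2) P :=
    Integrable.of_integral_ne_zero (by rw [hY2]; positivity)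
  have hsq : ∫ w, (Y w ^ 2 - 2 * Real.exp (-t) * Y w + Real.exp (-t) ^ 2) ∂P = 0 := by
    have e := integral_add (i2.sub (i1.const_mul (2 * Real.exp (-t))))
      (integrable_const (Real.exp (-t) ^ 2))
    simp only [Pi.sub_apply] at e
    rw [e, integral_sub i2 (i1.const_mul _), integral_const_mul, hY1, hY2]
    simp
    ring
  have hint : Integrable (fun w => Y w ^ 2 - 2 * Real.exp (-t) * Y w + Real.exp (-t) ^ 2) P :=
    (i2.sub (i1.const_mul (2 * Real.exp (-t)))).add (integrable_const (Real.exp (-t) ^ 2))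
  rw [integral_eq_zero_iff_of_nonneg (fun w => by
    change 0 ≤ Y w ^ 2 - 2 * Real.exp (-t) * Y w + Real.exp (-t) ^ 2
    nlinarith [sq_nonneg (Y w - Real.exp (-t))]) hint] at hsq
  have hae : X t.toNNReal =ᵐ[P] fun _ => t := by
    filter_upwards [hsq] with w hw
    have h0 : (Y w - Real.exp (-t)) ^ 2 = 0 := by
      rw [Pi.zero_apply] at hw
      linarith
    have h1 := sub_eq_zero.1 (pow_eq_zero_iff two_ne_zero |>.1 h0)
    rw [hY, Real.exp_eq_exp] at h1
    linarith
  rw [timeLaw, Measure.map_congr hae, Measure.map_const, measure_univ, one_smul]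

end Subordinator

/-! ### Transport along the diagonal -/

/-- The integrand is the derivative of `t ↦ φ (t, t)`, which vanishes at `0` and at infinity. -/
lemma integral_Ioi_deriv_add_deriv_diagonal {φ : ℝ × ℝ → ℝ} (hφ : ContDiff ℝ ∞ φ)
    (hc : HasCompactSupport φ) (hs : tsupport φ ⊆ Ioi 0 ×ˢ Ioi 0) :
    ∫ t in Ioi (0 : ℝ), (deriv (fun s => φ (t, s)) t + deriv (fun y => φ (y, t)) t) = 0 := by
  set g : ℝ → ℝ := fun t => φ (t, t) with hg
  have hgC : ContDiff ℝ 1 g := (hφ.of_le (by exact_mod_cast le_top)).comp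
    (contDiff_id.prodMk contDiff_id)
  have hemb : Topology.IsClosedEmbedding fun t : ℝ => (t, t) :=
    Topology.IsClosedEmbedding.of_continuous_injective_isClosedMap (by fun_prop)
      (fun a b h => (Prod.ext_iff.1 h).1)
      (Function.LeftInverse.isClosedEmbedding (f := Prod.fst) (fun _ => rfl) continuous_fst
        (by fun_prop)).isClosedMap
  have hgc : HasCompactSupport g := hc.comp_isClosedEmbedding hemb
  have hd : ∀ t, deriv g t = deriv (fun s => φ (t, s)) t + deriv (fun y => φ (y, t)) t := by
    intro t
    have hf : HasFDerivAt φ (fderiv ℝ φ (t, t)) (t, t) :=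
      (hφ.differentiable (by simp) (t, t)).hasFDerivAt
    have d0 : HasDerivAt g (fderiv ℝ φ (t, t) (1, 1)) t :=
      HasFDerivAt.comp_hasDerivAt (f := fun t : ℝ => (t, t)) t hf
        ((hasDerivAt_id' t).prodMk (hasDerivAt_id' t))
    have d1 : HasDerivAt (fun s => φ (t, s)) (fderiv ℝ φ (t, t) (0, 1)) t :=
      HasFDerivAt.comp_hasDerivAt (f := fun s : ℝ => (t, s)) t hf
        ((hasDerivAt_const t t).prodMk (hasDerivAt_id' t))
    have d2 : HasDerivAt (fun y => φ (y, t)) (fderiv ℝ φ (t, t) (1, 0)) t :=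
      HasFDerivAt.comp_hasDerivAt (f := fun y : ℝ => (y, t)) t hf
        ((hasDerivAt_id' t).prodMk (hasDerivAt_const t t))
    rw [d0.deriv, d1.deriv, d2.deriv, ← map_add]
    simp

  have hdc : Continuous (deriv g) := hgC.continuous_deriv le_rfl
  have hint : Integrable (deriv g) := hdc.integrable_of_hasCompactSupport hgc.deriv
  have h := integral_Ioi_of_hasDerivAt_of_tendsto (a := 0) (m := 0)
    hgC.continuous.continuousWithinAt
    (fun t _ => (hgC.differentiable one_ne_zero t).hasDerivAt) hint.integrableOn
    (hgc.is_zero_at_infty.mono_left atTop_le_cocompact)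
  have h0 : g 0 = 0 := by
    refine image_eq_zero_of_notMem_tsupport (f := φ) fun hmem => ?_
    exact lt_irrefl (0 : ℝ) (hs hmem).1
  rw [h0, sub_zero] at h
  simp only [hd] at h
  exact h

/-! ### The two cases of the theorem -/

theorem mainTheorem2 {Ω : Type*} [MeasurableSpace Ω] (P : Measure Ω) [IsProbabilityMeasure P]
    (ν : ℝ) (hν0 : 0 < ν) (hν1 : ν ≤ 1) (n : ℕ) (hn : 1 ≤ n)
    (X : ℝ≥0 → Ω → ℝ) (hX : IsStableSubordinator P (ν / n) X) :
    -- the case in which the law of the subordinator has a density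
    (ν / n < 1 → ∃ h : ℝ → ℝ → ℝ, IsContinuousDensity P X h ∧
      -- the equation, all of whose derivatives exist
      (∀ x t : ℝ, 0 < x → 0 < t →
        ContDiffAt ℝ n (fun s => h x s) t ∧
        RLDifferentiableAt ν (fun y => h y t) x ∧
        leftDeriv n (fun s => h x s) t - rlDeriv ν (fun y => h y t) x = 0) ∧
      -- the initial condition
      (∀ φ : ℝ →ᵇ ℝ, Tendsto (fun t => ∫ x, φ x * h x t) (𝓝[>] 0) (𝓝 (φ 0))) ∧
      -- the boundary condition
      (∀ t : ℝ, 0 < t → h 0 t = 0 ∧ Tendsto (fun x => h x t) (𝓝[>] 0) (𝓝 0)) ∧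
      -- the conditions on the derivatives in time
      (∀ k : ℕ, 0 < k → k < n → ∀ x : ℝ, 0 < x →
        Tendsto (fun t => leftDeriv k (fun s => h x s) t) (𝓝[>] 0)
          (𝓝 (Phi (ν * k / n + 1) x))) ∧
      -- the double Laplace transform
      (∀ l ξ : ℝ, 0 < l → 0 < ξ →
        (∫ t in Ioi (0 : ℝ), Real.exp (-(l * t)) *
          (∫ x in Ioi (0 : ℝ), Real.exp (-(ξ * x)) * h x t)) = 1 / (l + ξ ^ (ν / n)))) ∧
    -- the case `ν = n = 1`, where there is no density: the same problem for the laws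
    (ν / n = 1 →
      -- `(- ∂_t - ∂_x) law = 0` in the sense of distributions on `x > 0`, `t > 0`
      (∀ φ : ℝ × ℝ → ℝ, ContDiff ℝ ∞ φ → HasCompactSupport φ →
        tsupport φ ⊆ Ioi 0 ×ˢ Ioi 0 →
        (∫ t in Ioi (0 : ℝ),
          (∫ x, (deriv (fun s => φ (x, s)) t + deriv (fun y => φ (y, t)) x) ∂(timeLaw P X t))) = 0) ∧
      (∀ φ : ℝ →ᵇ ℝ, Tendsto (fun t => ∫ x, φ x ∂(timeLaw P X t)) (𝓝[>] 0) (𝓝 (φ 0))) ∧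
      (∀ t : ℝ, 0 < t → ∃ ε : ℝ, 0 < ε ∧ timeLaw P X t (Iio ε) = 0) ∧
      (∀ l ξ : ℝ, 0 < l → 0 < ξ →
        (∫ t in Ioi (0 : ℝ), Real.exp (-(l * t)) *
          (∫ x in Ioi (0 : ℝ), Real.exp (-(ξ * x)) ∂(timeLaw P X t))) = 1 / (l + ξ ^ (ν / n)))) := by
  have hn' : (0 : ℝ) < n := by exact_mod_cast hn
  have h0 : 0 < ν / n := by positivity
  refine ⟨fun h1 => ?_, fun h1 => ?_⟩
  · set α := ν / n with hα
    have hnα : n * α = ν := by rw [hα]; field_simp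
    set h : ℝ → ℝ → ℝ := fun x t => (bromwichIntegral α 0 x t).re with hh
    have hdens : ∀ t, 0 < t → (∀ x, 0 ≤ h x t) ∧ (∀ x ≤ 0, h x t = 0) ∧
        timeLaw P X t = volume.withDensity fun x => ENNReal.ofReal (h x t) := fun t ht => by
      have := hX.isProbabilityMeasure_timeLaw t
      exact eq_withDensity_bromwichIntegral h0 h1 ht (hX.ae_timeLaw_nonneg t)
        fun l hl => hX.integral_timeLaw_exp_neg ht.le hl
    have hcx : ∀ t, 0 < t → Continuous fun x => h x t := fun t ht =>
      (contDiff_one_re_bromwichIntegral_space h0 h1 0 ht).continuous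
    have hintegral : ∀ (φ : ℝ → ℝ) t, 0 < t →
        ∫ x, φ x ∂(timeLaw P X t) = ∫ x, φ x * h x t := fun φ t ht => by
      rw [(hdens t ht).2.2, integral_withDensity_eq_integral_toReal_smul
        (hcx t ht).measurable.ennreal_ofReal (by simp)]
      congr 1
      ext x
      rw [ENNReal.toReal_ofReal ((hdens t ht).1 x), smul_eq_mul, mul_comm]
    refine ⟨h, ⟨fun x t ht => (hdens t ht).1 x, fun x t ht hx => (hdens t ht).2.1 x hx, ?_,
      fun t ht => (hdens t ht).2.2⟩, fun x t hx ht => ?_, fun φ => ?_, fun t ht => ?_,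
      fun k hk0 hkn x hx => ?_, fun l ξ hl hξ => ?_⟩
    · exact Complex.continuous_re.comp_continuousOn (continuousOn_bromwichIntegral h0 h1 0)
    · obtain ⟨d1, d2⟩ := rlDifferentiableAt_and_rlDeriv_re_bromwichIntegral h0 h1 hν0 hν1 0 hx ht
        (hdens t ht).2.1
      refine ⟨(contDiffOn_re_bromwichIntegral_time h0 h1 x n 0).contDiffAt (Ioi_mem_nhds ht),
        d1, ?_⟩
      rw [hh, d2, leftDeriv_re_bromwichIntegral h0 h1 0 x n ht, hnα, sub_self]
    · refine (hX.tendsto_integral_timeLaw φ).congr' ?_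
      filter_upwards [self_mem_nhdsWithin] with t ht using hintegral φ t ht
    · have hz := (hdens t ht).2.1 0 le_rfl
      refine ⟨hz, ?_⟩
      have := ((hcx t ht).tendsto 0).mono_left (nhdsWithin_le_nhds (s := Ioi 0))
      rwa [hz] at this
    · have hk : (0 : ℝ) < k := by exact_mod_cast hk0
      have hkn' : (k : ℝ) < n := by exact_mod_cast hkn
      -- `kα < nα = ν ≤ 1`: this is where `k < n` enters.
      have hs1 : k * α < 1 := by
        have : k * α < n * α := mul_lt_mul_of_pos_right hkn' h0
        linarith
      have hlim := tendsto_bromwichIntegral_time_zero h0 h1 (mul_pos hk h0) hs1 hx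
      have hPhi : Phi (ν * k / n + 1) x = x ^ (-(k * α) - 1) / Real.Gamma (-(k * α)) := by
        have e : ν * k / n = k * α := by rw [hα]; ring
        rw [Phi, if_pos hx, e]
        congr 2 <;> ring
      rw [hPhi]
      refine hlim.congr' ?_
      filter_upwards [self_mem_nhdsWithin] with t ht
      rw [hh, leftDeriv_re_bromwichIntegral h0 h1 0 x k ht, zero_add]
    -- The inner integral is the full Laplace transform `exp (-t ξ^α)`, as `h` vanishes off `x > 0`.
    · rw [← integral_Ioi_exp_neg_mul_mul_exp_neg_mul hl (Real.rpow_pos_of_pos hξ α)]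
      refine setIntegral_congr_fun measurableSet_Ioi fun t ht => ?_
      have ht' : 0 < t := ht
      rw [← hX.integral_timeLaw_exp_neg ht'.le hξ, hintegral _ t ht',
        setIntegral_eq_integral_of_forall_compl_eq_zero]
      intro x hx
      rw [(hdens t ht').2.1 x (not_lt.1 hx), mul_zero]
  · rw [h1] at hX ⊢
    refine ⟨fun φ hφ hc hs => ?_, hX.tendsto_integral_timeLaw, fun t ht => ?_,
      fun l ξ hl hξ => ?_⟩
    · refine (setIntegral_congr_fun measurableSet_Ioi fun t ht => ?_).trans
        (integral_Ioi_deriv_add_deriv_diagonal hφ hc hs)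
      rw [hX.timeLaw_eq_dirac (le_of_lt ht), integral_dirac]
    · refine ⟨t, ht, ?_⟩
      rw [hX.timeLaw_eq_dirac ht.le, Measure.dirac_apply' _ measurableSet_Iio]
      simp
    · rw [← integral_Ioi_exp_neg_mul_mul_exp_neg_mul hl (Real.rpow_pos_of_pos hξ 1)]
      refine setIntegral_congr_fun measurableSet_Ioi fun t ht => ?_
      have ht' : 0 < t := ht
      rw [hX.timeLaw_eq_dirac ht'.le, restrict_dirac' measurableSet_Ioi, if_pos ht,
        integral_dirac, Real.rpow_one, mul_comm ξ]
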